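/- A subset $S$ of a group $G$ *invariably generates* $G$ if $G=\langle g(s)^{-1}\,s\,g(s) \mid s\in S\rangle$ for every choice of elements $g(s)\in G$ $(s\in S)$. A group is *FIG* if it is invariably generated by some finite subset, and for an FIG group $G$ we write $d_I(G)$ for the minimal cardinality of a finite subset that invariably generates $G$. A group is *virtually solvable* if it has a solvable subgroup of finite index. Let $G$ be the (first) Grigorchuk group, that is, the group of permutations of the set of finite words over $\{0,1\}$ (the vertices of the rooted binary tree) generated by $a,b,c,d$, each of which fixes the empty word, where for $x \in \{0,1\}$ and every word $w$ $$a(xw)=(1-x)w,$$ $$b(0w)=0\,a(w),\quad b(1w)=1\,c(w),$$ $$c(0w)=0\,a(w),\quad c(1w)=1\,d(w),$$ $$d(0w)=0\,w,\quad d(1w)=1\,b(w).$$ **Corollary 2.7.** The Grigorchuk group $G$ is FIG, and $d_I(G)=3$. Moreover, $G$ is residually finite and is not virtually solvable; thus residually finite FIG groups need not be virtually solvable. -/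

import Mathlib

/-- A subset `S` of a group `G` invariably generates `G` if, for every choice of elements
`g s ∈ G` (`s ∈ S`), the conjugates `s ^ (g s) = (g s)⁻¹ * s * g s` generate `G`. -/
def InvariablyGenerates {G : Type*} [Group G] (S : Set G) : Prop :=
  ∀ g : G → G, Subgroup.closure ((fun s => (g s)⁻¹ * s * g s) '' S) = ⊤

/-- A group is FIG if it is invariably generated by some finite subset. -/
def IsFIG (G : Type*) [Group G] : Prop :=
  ∃ S : Finset G, InvariablyGenerates (S : Set G)

/-- The minimal number of invariable generators of an FIG group
(with the junk value `0` for groups that are not FIG). -/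
noncomputable def invariableRank (G : Type*) [Group G] : ℕ :=
  sInf {n : ℕ | ∃ S : Finset G, S.card = n ∧ InvariablyGenerates (S : Set G)}

/-- A group is virtually solvable if it has a solvable subgroup of finite index. -/
def IsVirtuallySolvable (G : Type*) [Group G] : Prop :=
  ∃ H : Subgroup G, H.FiniteIndex ∧ Group.IsSolvable H

namespace Grigorchuk

/-- The states of the Grigorchuk automaton; `e` is the inactive state. -/
inductive State where
  | e | a | b | c | d

/-- The letter that a state outputs on reading a letter: only `a` changes it. -/
def State.output : State → Bool → Bool
  | .a, x => !x
  | _, x => x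

/-- The next state, encoding `a = (1, 1)σ`, `b = (a, c)`, `c = (a, d)`, `d = (1, b)`, where the
first entry is for the letter `false` and the second one for the letter `true`. -/
def State.next : State → Bool → State
  | .b, false => .a
  | .b, true => .c
  | .c, false => .a
  | .c, true => .d
  | .d, false => .e
  | .d, true => .b
  | _, _ => .e

/-- The action of a state on the vertices of the rooted binary tree, which are the finite words
over `Bool`; the empty word is the root. -/
def State.act : State → List Bool → List Bool
  | _, [] => []
  | s, x :: w => s.output x :: (s.next x).act w

theorem State.act_involutive (s : State) : Function.Involutive s.act := by
  intro w
  induction w generalizing s with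
  | nil => rfl
  | cons x w ih =>
    have h : (s.next (s.output x)) = s.next x := by cases s <;> cases x <;> rfl
    have h' : s.output (s.output x) = x := by cases s <;> cases x <;> rfl
    simp only [State.act, h, h', ih]

/-- The permutation of the vertices of the rooted binary tree given by a state. -/
def State.perm (s : State) : Equiv.Perm (List Bool) :=
  s.act_involutive.toPerm s.act

end Grigorchuk

/-- The (first) Grigorchuk group: the group of automorphisms of the rooted binary tree generated
by `a, b, c, d`. -/
def grigorchukGroup : Subgroup (Equiv.Perm (List Bool)) :=
  Subgroup.closure {Grigorchuk.State.a.perm, Grigorchuk.State.b.perm,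
    Grigorchuk.State.c.perm, Grigorchuk.State.d.perm}

/-! Write (f, g) for `pair f g`. Lower bound: the signs of the actions on levels 1, 2, 3 map the
group onto (ℤ/2)³, which two elements cannot generate (`closure_pair_ne_top`).

Upper bound: conjugates of a and of any two distinct letters x, y among b, c, d generate
(`conjGenerates`). Allowing any two letters makes the claim stable under sections, because the
sections at 1 permute b → c → d → b. Let H contain such conjugates, with x ≠ d. Its section at 0
contains conjugates of a and of the next letters, and after normalization the conjugators have
smaller total weight, so by induction the section is full (`ConjGenerates.of_sections`,
`conjGenerates_of_weight`). Then H contains some (1, n) with n ≠ 1, and the z with (z, 1) ∈ H form a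
nontrivial normal subgroup. That subgroup contains a level stabilizer
(`IsNormalIn.isCongruence_of_ne_one`), hence so does H. Level quotients are finite 2-groups, so
their maximal subgroups are normal, and H is everything (`IsCongruence.grigorchukGroup_le`).

The theorem on normal subgroups rests on K, the normal closure of (ab)², which contains K × 1 and
the stabilizer of level 3. If n ∈ N moves v, commutators put a copy of [K, K] below v into N;
passing to sections five more times puts K itself into an iterated rigid part of N.

The same theorem excludes virtual solvability: a nontrivial normal subgroup contains noncommuting
copies of elements of K, so its derived series never becomes trivial. Residual finiteness is the
faithfulness of the action on all levels together. -/

namespace Grigorchuk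

open Equiv

local notation "σa" => State.perm State.a
local notation "σb" => State.perm State.b
local notation "σc" => State.perm State.c
local notation "σd" => State.perm State.d

/-! ### Pairs of permutations acting on the two subtrees -/

/-- The permutation of the tree that acts as `f` below the vertex `0` and as `g` below `1`. -/
def pair (f g : Perm (List Bool)) : Perm (List Bool) where
  toFun
    | [] => []
    | false :: w => false :: f w
    | true :: w => true :: g w
  invFun
    | [] => []
    | false :: w => false :: f.symm w
    | true :: w => true :: g.symm w
  left_inv w := by rcases w with _ | ⟨_ | _, w⟩ <;> simp
  right_inv w := by rcases w with _ | ⟨_ | _, w⟩ <;> simp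

@[simp] theorem pair_nil (f g : Perm (List Bool)) : pair f g [] = [] := rfl

@[simp] theorem pair_false (f g : Perm (List Bool)) (w : List Bool) :
    pair f g (false :: w) = false :: f w := rfl

@[simp] theorem pair_true (f g : Perm (List Bool)) (w : List Bool) :
    pair f g (true :: w) = true :: g w := rfl

@[simp] theorem pair_one_one : pair 1 1 = 1 := by
  ext1 w; rcases w with _ | ⟨_ | _, w⟩ <;> rfl

theorem pair_mul (f g f' g' : Perm (List Bool)) :
    pair f g * pair f' g' = pair (f * f') (g * g') := by
  ext1 w; rcases w with _ | ⟨_ | _, w⟩ <;> rfl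

theorem pair_inv (f g : Perm (List Bool)) : (pair f g)⁻¹ = pair f⁻¹ g⁻¹ := by
  rw [inv_eq_iff_mul_eq_one, pair_mul]; simp

theorem pair_inj {f g f' g' : Perm (List Bool)} :
    pair f g = pair f' g' ↔ f = f' ∧ g = g' := by
  refine ⟨fun h => ⟨?_, ?_⟩, by rintro ⟨rfl, rfl⟩; rfl⟩
  · ext1 w
    simpa using DFunLike.congr_fun h (false :: w)
  · ext1 w
    simpa using DFunLike.congr_fun h (true :: w)

theorem pair_pow (f g : Perm (List Bool)) (n : ℕ) : pair f g ^ n = pair (f ^ n) (g ^ n) := by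
  induction n with
  | zero => simp
  | succ n ih => rw [pow_succ, pow_succ, pow_succ, ih, pair_mul]

/-! ### The generators -/

@[simp] theorem State.perm_apply (s : State) (w : List Bool) : s.perm w = s.act w := rfl

theorem State.e_perm : State.e.perm = 1 := by
  ext1 w
  change State.e.act w = w
  induction w with
  | nil => rfl
  | cons x w ih => simpa [State.act, State.output, State.next] using ih

theorem State.perm_mul_self (s : State) : s.perm * s.perm = 1 := by
  ext1 w; exact s.act_involutive w

theorem State.perm_inv (s : State) : s.perm⁻¹ = s.perm :=
  inv_eq_of_mul_eq_one_left s.perm_mul_self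

theorem b_perm : σb = pair σa σc := by
  ext1 w; rcases w with _ | ⟨_ | _, w⟩ <;> rfl

theorem c_perm : σc = pair σa σd := by
  ext1 w; rcases w with _ | ⟨_ | _, w⟩ <;> rfl

theorem d_perm : σd = pair 1 σb := by
  rw [← State.e_perm]
  ext1 w; rcases w with _ | ⟨_ | _, w⟩ <;> rfl

theorem e_act (w : List Bool) : State.e.act w = w := by
  have := DFunLike.congr_fun State.e_perm w
  simpa using this

@[simp] theorem a_nil : State.a.act [] = [] := rfl

@[simp] theorem a_cons (x : Bool) (w : List Bool) : State.a.act (x :: w) = (!x) :: w := by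
  simp [State.act, State.output, State.next, e_act]

theorem a_mul_pair (f g : Perm (List Bool)) : σa * pair f g = pair g f * σa := by
  ext1 w; rcases w with _ | ⟨_ | _, w⟩ <;> simp

theorem a_conj_pair (f g : Perm (List Bool)) : σa * pair f g * σa = pair g f := by
  rw [a_mul_pair, mul_assoc, State.perm_mul_self, mul_one]

theorem a_mul_a_mul (g : Perm (List Bool)) : σa * (σa * g) = g := by
  rw [← mul_assoc, State.perm_mul_self, one_mul]

theorem a_mul_pair_mul (f g h : Perm (List Bool)) :
    σa * (pair f g * h) = pair g f * (σa * h) := by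
  rw [← mul_assoc, a_mul_pair, mul_assoc]

theorem pair_mul_mul (f g f' g' h : Perm (List Bool)) :
    pair f g * (pair f' g' * h) = pair (f * f') (g * g') * h := by
  rw [← mul_assoc, pair_mul]

theorem pair_ne_pair_mul_a (f g f' g' : Perm (List Bool)) : pair f g ≠ pair f' g' * σa := by
  intro h
  have := DFunLike.congr_fun h [false]
  simp at this

theorem bc_mul : σb * σc = σd := by
  -- The three identities need a joint induction: below the letter 1, each becomes the next one
  -- cyclically.
  have key : ∀ w : List Bool, σb (σc w) = σd w ∧ σc (σd w) = σb w ∧ σd (σb w) = σc w := by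
    intro w
    induction w with
    | nil => exact ⟨rfl, rfl, rfl⟩
    | cons x w ih =>
      simp only [State.perm_apply] at ih
      cases x <;>
        simp [State.act, State.output, State.next, e_act, ih, State.act_involutive State.a w]
  ext1 w
  exact (key w).1

theorem cb_mul : σc * σb = σd := by
  rw [← inv_inj, mul_inv_rev, State.perm_inv, State.perm_inv, State.perm_inv, bc_mul]

theorem bd_mul : σb * σd = σc := by
  rw [← bc_mul, ← mul_assoc, State.perm_mul_self, one_mul]

theorem db_mul : σd * σb = σc := by
  rw [← cb_mul, mul_assoc, State.perm_mul_self, mul_one]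

theorem cd_mul : σc * σd = σb := by
  rw [← cb_mul, ← mul_assoc, State.perm_mul_self, one_mul]

theorem dc_mul : σd * σc = σb := by
  rw [← bc_mul, mul_assoc, State.perm_mul_self, mul_one]

/-! ### The group and its sections -/

theorem a_mem : σa ∈ grigorchukGroup := Subgroup.subset_closure (by simp)
theorem b_mem : σb ∈ grigorchukGroup := Subgroup.subset_closure (by simp)
theorem c_mem : σc ∈ grigorchukGroup := Subgroup.subset_closure (by simp)
theorem d_mem : σd ∈ grigorchukGroup := Subgroup.subset_closure (by simp)

theorem grigorchukGroup_le {H : Subgroup (Perm (List Bool))} (ha : σa ∈ H) (hb : σb ∈ H)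
    (hc : σc ∈ H) (hd : σd ∈ H) : grigorchukGroup ≤ H := by
  refine (Subgroup.closure_le _).2 ?_
  rintro _ (rfl | rfl | rfl | rfl) <;> assumption

/-- The permutations that are, up to `a`, pairs of elements of the Grigorchuk group. -/
def pairSubgroup : Subgroup (Perm (List Bool)) where
  carrier := {g | ∃ u ∈ grigorchukGroup, ∃ v ∈ grigorchukGroup, g = pair u v ∨ g = pair u v * σa}
  one_mem' := ⟨1, one_mem _, 1, one_mem _, Or.inl (by simp)⟩
  mul_mem' := by
    rintro _ _ ⟨u, hu, v, hv, rfl | rfl⟩ ⟨u', hu', v', hv', rfl | rfl⟩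
    · exact ⟨_, mul_mem hu hu', _, mul_mem hv hv', Or.inl (pair_mul _ _ _ _)⟩
    · exact ⟨_, mul_mem hu hu', _, mul_mem hv hv', Or.inr (by rw [← mul_assoc, pair_mul])⟩
    · exact ⟨_, mul_mem hu hv', _, mul_mem hv hu', Or.inr (by
        rw [mul_assoc, a_mul_pair, ← mul_assoc, pair_mul])⟩
    · exact ⟨_, mul_mem hu hv', _, mul_mem hv hu', Or.inl (by
        rw [mul_assoc, a_mul_pair_mul, State.perm_mul_self, mul_one, pair_mul])⟩
  inv_mem' := by
    rintro _ ⟨u, hu, v, hv, rfl | rfl⟩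
    · exact ⟨_, inv_mem hu, _, inv_mem hv, Or.inl (pair_inv _ _)⟩
    · exact ⟨_, inv_mem hv, _, inv_mem hu, Or.inr (by
        rw [mul_inv_rev, pair_inv, State.perm_inv, a_mul_pair])⟩

theorem exists_pair {g : Perm (List Bool)} (hg : g ∈ grigorchukGroup) :
    ∃ u ∈ grigorchukGroup, ∃ v ∈ grigorchukGroup, g = pair u v ∨ g = pair u v * σa := by
  have : grigorchukGroup ≤ pairSubgroup := grigorchukGroup_le
    ⟨1, one_mem _, 1, one_mem _, Or.inr (by simp)⟩
    ⟨_, a_mem, _, c_mem, Or.inl b_perm⟩ ⟨_, a_mem, _, d_mem, Or.inl c_perm⟩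
    ⟨_, one_mem _, _, b_mem, Or.inl d_perm⟩
  exact this hg

theorem pair_swap_mem {f g : Perm (List Bool)} (h : pair f g ∈ grigorchukGroup) :
    pair g f ∈ grigorchukGroup := by
  rw [← a_conj_pair]; exact mul_mem (mul_mem a_mem h) a_mem

theorem mem_of_pair_mem {f g : Perm (List Bool)} (h : pair f g ∈ grigorchukGroup) :
    f ∈ grigorchukGroup ∧ g ∈ grigorchukGroup := by
  obtain ⟨u, hu, v, hv, h' | h'⟩ := exists_pair h
  · obtain ⟨rfl, rfl⟩ := pair_inj.1 h'
    exact ⟨hu, hv⟩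
  · exact absurd h' (pair_ne_pair_mul_a _ _ _ _)

/-- The elements that occur as the section at `0` of an element of `H` fixing the first level. -/
def sectionSubgroup (H : Subgroup (Perm (List Bool))) : Subgroup (Perm (List Bool)) where
  carrier := {u | ∃ v, pair u v ∈ H}
  one_mem' := ⟨1, by simp [one_mem]⟩
  mul_mem' := by
    rintro u u' ⟨v, hv⟩ ⟨v', hv'⟩
    exact ⟨v * v', by rw [← pair_mul]; exact mul_mem hv hv'⟩
  inv_mem' := by
    rintro u ⟨v, hv⟩
    exact ⟨v⁻¹, by rw [← pair_inv]; exact inv_mem hv⟩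

/-- The group is self-replicating: b, ada, aba, aca have the sections a, b, c, d at 0. -/
theorem le_sectionSubgroup : grigorchukGroup ≤ sectionSubgroup grigorchukGroup :=
  grigorchukGroup_le ⟨σc, b_perm ▸ b_mem⟩ ⟨1, pair_swap_mem (d_perm ▸ d_mem)⟩
    ⟨σa, pair_swap_mem (b_perm ▸ b_mem)⟩ ⟨σa, pair_swap_mem (c_perm ▸ c_mem)⟩

theorem exists_pair_mem {u : Perm (List Bool)} (hu : u ∈ grigorchukGroup) :
    ∃ v ∈ grigorchukGroup, pair u v ∈ grigorchukGroup := by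
  obtain ⟨v, hv⟩ := le_sectionSubgroup hu
  exact ⟨v, (mem_of_pair_mem hv).2, hv⟩

/-! ### Tree automorphisms and level stabilizers -/

/-- The permutations that preserve the levels and the prefix relation. -/
def treeAut : Subgroup (Perm (List Bool)) where
  carrier := {g | ∀ w, (g w).length = w.length ∧ ∀ n, (g w).take n = g (w.take n)}
  one_mem' := fun w => by simp
  mul_mem' := by
    intro g h hg hh w
    refine ⟨by rw [Perm.mul_apply, (hg _).1, (hh _).1], fun n => ?_⟩
    rw [Perm.mul_apply, (hg _).2, (hh _).2, Perm.mul_apply]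
  inv_mem' := by
    intro g hg w
    refine ⟨by rw [← (hg (g⁻¹ w)).1, show g (g⁻¹ w) = w by simp], fun n => ?_⟩
    apply g.injective
    rw [← (hg _).2, show g (g⁻¹ w) = w by simp]
    simp

theorem State.perm_mem_treeAut (s : State) : s.perm ∈ treeAut := by
  intro w
  simp only [State.perm_apply]
  induction w generalizing s with
  | nil => simp [State.act]
  | cons x w ih =>
    refine ⟨by simp [State.act, (ih _).1], fun n => ?_⟩
    cases n with
    | zero => simp [State.act]
    | succ n => simp [State.act, (ih _).2]

theorem le_treeAut : grigorchukGroup ≤ treeAut :=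
  grigorchukGroup_le (State.perm_mem_treeAut _) (State.perm_mem_treeAut _)
    (State.perm_mem_treeAut _) (State.perm_mem_treeAut _)

/-- The pointwise stabilizer of the vertices of level at most `n`. -/
def levelStab (n : ℕ) : Subgroup (Perm (List Bool)) where
  carrier := {g | ∀ w : List Bool, w.length ≤ n → g w = w}
  one_mem' := fun _ _ => rfl
  mul_mem' := fun {g h} hg hh w hw => by rw [Perm.mul_apply, hh w hw, hg w hw]
  inv_mem' := fun {g} hg w hw => by rw [Perm.inv_eq_iff_eq, hg w hw]

theorem pair_mem_levelStab {n : ℕ} {f g : Perm (List Bool)} :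
    pair f g ∈ levelStab (n + 1) ↔ f ∈ levelStab n ∧ g ∈ levelStab n := by
  refine ⟨fun h => ⟨fun w hw => ?_, fun w hw => ?_⟩, fun ⟨hf, hg⟩ w hw => ?_⟩
  · simpa using h (false :: w) (by simpa using hw)
  · simpa using h (true :: w) (by simpa using hw)
  · rcases w with _ | ⟨_ | _, w⟩
    · rfl
    · simp [hf w (by simpa using hw)]
    · simp [hg w (by simpa using hw)]

theorem exists_pair_of_mem_levelStab {n : ℕ} {g : Perm (List Bool)} (hg : g ∈ grigorchukGroup)
    (hs : g ∈ levelStab (n + 1)) : ∃ u ∈ grigorchukGroup, ∃ v ∈ grigorchukGroup,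
      u ∈ levelStab n ∧ v ∈ levelStab n ∧ g = pair u v := by
  obtain ⟨u, hu, v, hv, rfl | rfl⟩ := exists_pair hg
  · exact ⟨u, hu, v, hv, (pair_mem_levelStab.1 hs).1, (pair_mem_levelStab.1 hs).2, rfl⟩
  · have := hs [false] (by simp)
    simp at this

/-- A square fixes the first level, so it is a pair of elements of the group, to which induction
applies. Hence the level quotients are 2-groups. -/
theorem pow_mem_levelStab {g : Perm (List Bool)} (hg : g ∈ grigorchukGroup) (n : ℕ) :
    g ^ 2 ^ n ∈ levelStab n := by
  induction n generalizing g with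
  | zero =>
    intro w hw
    have h := (le_treeAut (pow_mem hg (2 ^ 0)) w).1
    rw [List.length_eq_zero_iff.1 (Nat.le_zero.1 hw)] at h ⊢
    exact List.length_eq_zero_iff.1 h
  | succ n ih =>
    have : ∃ u ∈ grigorchukGroup, ∃ v ∈ grigorchukGroup, g ^ 2 = pair u v := by
      obtain ⟨u, hu, v, hv, rfl | rfl⟩ := exists_pair hg
      · exact ⟨_, pow_mem hu 2, _, pow_mem hv 2, pair_pow _ _ _⟩
      · exact ⟨_, mul_mem hu hv, _, mul_mem hv hu, by
          rw [pow_two, mul_assoc, a_mul_pair_mul, State.perm_mul_self, mul_one, pair_mul]⟩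
    obtain ⟨u, hu, v, hv, h⟩ := this
    rw [pow_succ', pow_mul, h, pair_pow, pair_mem_levelStab]
    exact ⟨ih hu, ih hv⟩

/-! ### Signs of the actions on the levels -/

/-- The action of the tree automorphisms on the vertices of level `n`. -/
def levelAct (n : ℕ) : treeAut →* Perm (List.Vector Bool n) where
  toFun g := (g : Perm (List Bool)).subtypePerm fun w => by rw [(g.2 w).1]
  map_one' := rfl
  map_mul' _ _ := rfl

open Classical in
/-- The sign of the action of `g` on the vertices of level `n`
(with the junk value `1` if `g` is not a tree automorphism). -/
noncomputable def levelSign (n : ℕ) (g : Perm (List Bool)) : ℤˣ :=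
  if h : g ∈ treeAut then Perm.sign (levelAct n ⟨g, h⟩) else 1

theorem levelSign_def {n : ℕ} {g : Perm (List Bool)} (h : g ∈ treeAut) :
    levelSign n g = Perm.sign (levelAct n ⟨g, h⟩) := dif_pos h

theorem levelSign_mul (n : ℕ) {g h : Perm (List Bool)} (hg : g ∈ grigorchukGroup)
    (hh : h ∈ grigorchukGroup) : levelSign n (g * h) = levelSign n g * levelSign n h := by
  rw [levelSign_def (le_treeAut hg), levelSign_def (le_treeAut hh),
    levelSign_def (le_treeAut (mul_mem hg hh)), ← map_mul, ← map_mul]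
  rfl

theorem levelSign_one (n : ℕ) : levelSign n 1 = 1 := by
  rw [levelSign_def (one_mem _), show levelAct n ⟨1, one_mem _⟩ = 1 from rfl, map_one]

theorem levelSign_inv (n : ℕ) {g : Perm (List Bool)} (hg : g ∈ grigorchukGroup) :
    levelSign n g⁻¹ = levelSign n g := by
  have h := levelSign_mul n (inv_mem hg) hg
  rw [inv_mul_cancel, levelSign_one] at h
  rw [← mul_one (levelSign n g⁻¹), ← Int.units_mul_self (levelSign n g), ← mul_assoc, ← h, one_mul]

theorem levelSign_pow (n : ℕ) {g : Perm (List Bool)} (hg : g ∈ grigorchukGroup) (j : ℕ) :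
    levelSign n (g ^ j) = levelSign n g ^ j := by
  induction j with
  | zero => simp [levelSign_one]
  | succ j ih => rw [pow_succ, levelSign_mul n (pow_mem hg j) hg, ih, pow_succ]

theorem levelSign_conj (n : ℕ) {g h : Perm (List Bool)} (hg : g ∈ grigorchukGroup)
    (hh : h ∈ grigorchukGroup) : levelSign n (g * h * g⁻¹) = levelSign n h := by
  rw [levelSign_mul n (mul_mem hg hh) (inv_mem hg), levelSign_mul n hg hh, levelSign_inv n hg,
    mul_comm, ← mul_assoc, Int.units_mul_self, one_mul]

theorem levelSign_conj' (n : ℕ) {g h : Perm (List Bool)} (hg : g ∈ grigorchukGroup)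
    (hh : h ∈ grigorchukGroup) : levelSign n (g⁻¹ * h * g) = levelSign n h := by
  simpa using levelSign_conj n (inv_mem hg) hh

theorem levelSign_eq_one_of_mem_levelStab {n : ℕ} {g : Perm (List Bool)}
    (hg : g ∈ grigorchukGroup) (hs : g ∈ levelStab n) : levelSign n g = 1 := by
  have : levelAct n ⟨g, le_treeAut hg⟩ = 1 := by
    ext1 w
    exact Subtype.ext (hs _ w.2.le)
  rw [levelSign_def (le_treeAut hg), this, map_one]

theorem levelSign_perm (n : ℕ) (s : State) :
    levelSign n s.perm = Perm.sign (levelAct n ⟨s.perm, s.perm_mem_treeAut⟩) := levelSign_def _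

theorem levelSign_one_a : levelSign 1 σa = -1 := by rw [levelSign_perm]; decide
theorem levelSign_one_b : levelSign 1 σb = 1 := by rw [levelSign_perm]; decide
theorem levelSign_one_c : levelSign 1 σc = 1 := by rw [levelSign_perm]; decide
theorem levelSign_one_d : levelSign 1 σd = 1 := by rw [levelSign_perm]; decide
theorem levelSign_two_a : levelSign 2 σa = 1 := by rw [levelSign_perm]; decide
theorem levelSign_two_b : levelSign 2 σb = -1 := by rw [levelSign_perm]; decide
theorem levelSign_two_c : levelSign 2 σc = -1 := by rw [levelSign_perm]; decide
theorem levelSign_two_d : levelSign 2 σd = 1 := by rw [levelSign_perm]; decide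
theorem levelSign_three_a : levelSign 3 σa = 1 := by rw [levelSign_perm]; decide
theorem levelSign_three_b : levelSign 3 σb = -1 := by rw [levelSign_perm]; decide
theorem levelSign_three_c : levelSign 3 σc = 1 := by rw [levelSign_perm]; decide
theorem levelSign_three_d : levelSign 3 σd = -1 := by rw [levelSign_perm]; decide

/-! ### Normal subgroups of the Grigorchuk group -/

/-- `N` is a normal subgroup of the Grigorchuk group. -/
structure IsNormalIn (N : Subgroup (Perm (List Bool))) : Prop where
  le : N ≤ grigorchukGroup
  conj_mem : ∀ g ∈ grigorchukGroup, ∀ n ∈ N, g * n * g⁻¹ ∈ N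

theorem IsNormalIn.conj_mem' {N : Subgroup (Perm (List Bool))} (hN : IsNormalIn N)
    {g n : Perm (List Bool)} (hg : g ∈ grigorchukGroup) (hn : n ∈ N) : g⁻¹ * n * g ∈ N := by
  simpa using hN.conj_mem _ (inv_mem hg) n hn

/-- The normal closure of `(ab)²` in the Grigorchuk group. -/
def kSubgroup : Subgroup (Perm (List Bool)) :=
  Subgroup.closure {k | ∃ g ∈ grigorchukGroup, k = g * ((σa * σb) ^ 2) * g⁻¹}

theorem ab_sq_mem_grigorchukGroup : (σa * σb) ^ 2 ∈ grigorchukGroup :=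
  pow_mem (mul_mem a_mem b_mem) 2

theorem isNormalIn_kSubgroup : IsNormalIn kSubgroup where
  le := by
    refine (Subgroup.closure_le _).2 ?_
    rintro _ ⟨g, hg, rfl⟩
    exact mul_mem (mul_mem hg ab_sq_mem_grigorchukGroup) (inv_mem hg)
  conj_mem g hg n hn := by
    have : kSubgroup ≤ kSubgroup.comap (MulAut.conj g).toMonoidHom := by
      refine (Subgroup.closure_le _).2 ?_
      rintro _ ⟨h, hh, rfl⟩
      exact Subgroup.subset_closure ⟨g * h, mul_mem hg hh, by simp [mul_assoc]⟩
    exact this hn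

theorem ab_sq_mem_kSubgroup : (σa * σb) ^ 2 ∈ kSubgroup :=
  Subgroup.subset_closure ⟨1, one_mem _, by simp⟩

theorem IsNormalIn.kSubgroup_le {N : Subgroup (Perm (List Bool))} (hN : IsNormalIn N)
    (h : (σa * σb) ^ 2 ∈ N) : kSubgroup ≤ N := by
  refine (Subgroup.closure_le _).2 ?_
  rintro _ ⟨g, hg, rfl⟩
  exact hN.conj_mem g hg _ h

theorem ab_sq_eq : (σa * σb) ^ 2 = pair (σc * σa) (σa * σc) := by
  rw [pow_two, b_perm, mul_assoc, a_mul_pair_mul, a_mul_a_mul, pair_mul]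

theorem ca_sq_eq : (σc * σa) ^ 2 = pair (σa * σd) (σd * σa) := by
  rw [pow_two, c_perm, mul_assoc, a_mul_pair_mul, pair_mul_mul, State.perm_mul_self, mul_one]

theorem ad_sq_eq : (σa * σd) ^ 2 = pair σb σb := by
  rw [pow_two, mul_assoc]
  nth_rw 1 [d_perm]
  rw [a_mul_pair_mul, a_mul_a_mul, d_perm, pair_mul, mul_one, one_mul]

/-- The source of branching: ((ab)², 1) is the commutator of (ab)⁻² with (b, 1), because cbc = b. -/
theorem pair_ab_sq_one :
    pair ((σa * σb) ^ 2) 1 = ((σa * σb) ^ 2)⁻¹ * (pair σb 1 * (σa * σb) ^ 2 * (pair σb 1)⁻¹) := by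
  rw [ab_sq_eq, pair_inv, pair_inv, pair_mul, pair_mul, pair_mul, ← ab_sq_eq, pair_inj]
  refine ⟨?_, by group⟩
  simp only [mul_inv_rev, State.perm_inv, pow_two, mul_assoc]
  rw [← mul_assoc σc σb, cb_mul, ← mul_assoc σd σc, dc_mul]

theorem pair_b_one_mem : pair σb 1 ∈ grigorchukGroup := pair_swap_mem (d_perm ▸ d_mem)

/-- The elements of the Grigorchuk group whose rigid copy at the vertex `0` lies in `N`. -/
def rigidPart (N : Subgroup (Perm (List Bool))) : Subgroup (Perm (List Bool)) where
  carrier := {x | x ∈ grigorchukGroup ∧ pair x 1 ∈ N}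
  one_mem' := ⟨one_mem _, by simp [one_mem]⟩
  mul_mem' := fun hx hy => ⟨mul_mem hx.1 hy.1, by
    simpa [pair_mul] using mul_mem hx.2 hy.2⟩
  inv_mem' := fun hx => ⟨inv_mem hx.1, by simpa [pair_inv] using inv_mem hx.2⟩

theorem IsNormalIn.rigidPart {N : Subgroup (Perm (List Bool))} (hN : IsNormalIn N) :
    IsNormalIn (rigidPart N) where
  le := fun _ hx => hx.1
  conj_mem g hg n hn := by
    obtain ⟨v, -, hv⟩ := exists_pair_mem hg
    refine ⟨mul_mem (mul_mem hg hn.1) (inv_mem hg), ?_⟩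
    simpa [pair_mul, pair_inv] using hN.conj_mem _ hv _ hn.2

theorem IsNormalIn.pair_swap_mem {N : Subgroup (Perm (List Bool))} (hN : IsNormalIn N)
    {f g : Perm (List Bool)} (h : pair f g ∈ N) : pair g f ∈ N := by
  rw [← a_conj_pair]; simpa [State.perm_inv] using hN.conj_mem _ a_mem _ h

theorem kSubgroup_le_rigidPart : kSubgroup ≤ rigidPart kSubgroup := by
  refine isNormalIn_kSubgroup.rigidPart.kSubgroup_le ⟨ab_sq_mem_grigorchukGroup, ?_⟩
  rw [pair_ab_sq_one]
  exact mul_mem (inv_mem ab_sq_mem_kSubgroup)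
    (isNormalIn_kSubgroup.conj_mem _ pair_b_one_mem _ ab_sq_mem_kSubgroup)

theorem pair_one_mem_kSubgroup {k : Perm (List Bool)} (hk : k ∈ kSubgroup) :
    pair k 1 ∈ kSubgroup := (kSubgroup_le_rigidPart hk).2

/-- `N` contains the stabilizer of some level in the Grigorchuk group. -/
def IsCongruence (N : Subgroup (Perm (List Bool))) : Prop :=
  ∃ m, grigorchukGroup ⊓ levelStab m ≤ N

theorem IsCongruence.of_pair {N H : Subgroup (Perm (List Bool))} (hN : IsCongruence N)
    (h₀ : ∀ n ∈ N, pair n 1 ∈ H) (h₁ : ∀ n ∈ N, pair 1 n ∈ H) : IsCongruence H := by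
  obtain ⟨m, hm⟩ := hN
  refine ⟨m + 1, fun g hg => ?_⟩
  obtain ⟨u, hu, v, hv, hu', hv', rfl⟩ := exists_pair_of_mem_levelStab hg.1 hg.2
  have : pair u v = pair u 1 * pair 1 v := by simp [pair_mul]
  rw [this]
  exact mul_mem (h₀ _ (hm ⟨hu, hu'⟩)) (h₁ _ (hm ⟨hv, hv'⟩))

theorem IsNormalIn.isCongruence {N : Subgroup (Perm (List Bool))} (hN : IsNormalIn N)
    (h : IsCongruence (Grigorchuk.rigidPart N)) : IsCongruence N :=
  h.of_pair (fun _ hn => hn.2) fun _ hn => hN.pair_swap_mem hn.2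

/-! ### The subgroup `K` contains the stabilizer of the third level -/

theorem levelSign_kSubgroup (n : ℕ) {k : Perm (List Bool)} (hk : k ∈ kSubgroup) :
    levelSign n k = 1 := by
  induction hk using Subgroup.closure_induction with
  | mem k hk =>
    obtain ⟨g, hg, rfl⟩ := hk
    rw [levelSign_conj n hg ab_sq_mem_grigorchukGroup,
      levelSign_pow n (mul_mem a_mem b_mem), Int.units_sq]
  | one => exact levelSign_one n
  | mul x y hx hy ihx ihy =>
    rw [levelSign_mul n (isNormalIn_kSubgroup.le hx) (isNormalIn_kSubgroup.le hy), ihx, ihy, one_mul]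
  | inv x hx ih => rw [levelSign_inv n (isNormalIn_kSubgroup.le hx), ih]

/-- The sections ca and ac of (ab)² have sign -1 on both levels 1 and 2, and conjugation preserves
signs. This parity separates K from (b, b)K, which the level signs cannot do since (b, b) = (ad)² is
a square. -/
theorem kSubgroup_sections {k : Perm (List Bool)} (hk : k ∈ kSubgroup) :
    ∃ u ∈ grigorchukGroup, ∃ v ∈ grigorchukGroup, k = pair u v ∧
      levelSign 1 u * levelSign 2 u = 1 ∧ levelSign 1 v * levelSign 2 v = 1 := by
  induction hk using Subgroup.closure_induction with
  | mem k hk =>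
    obtain ⟨g, hg, rfl⟩ := hk
    have hca := mul_mem c_mem a_mem
    have hac := mul_mem a_mem c_mem
    have e1 : levelSign 1 (σc * σa) * levelSign 2 (σc * σa) = 1 := by
      rw [levelSign_mul 1 c_mem a_mem, levelSign_mul 2 c_mem a_mem, levelSign_one_c,
        levelSign_one_a, levelSign_two_c, levelSign_two_a]; rfl
    have e2 : levelSign 1 (σa * σc) * levelSign 2 (σa * σc) = 1 := by
      rw [levelSign_mul 1 a_mem c_mem, levelSign_mul 2 a_mem c_mem, levelSign_one_c,
        levelSign_one_a, levelSign_two_c, levelSign_two_a]; rfl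
    obtain ⟨u, hu, v, hv, rfl | rfl⟩ := exists_pair hg
    · refine ⟨u * (σc * σa) * u⁻¹, mul_mem (mul_mem hu hca) (inv_mem hu),
        v * (σa * σc) * v⁻¹, mul_mem (mul_mem hv hac) (inv_mem hv), ?_, ?_, ?_⟩
      · rw [ab_sq_eq, pair_inv, pair_mul, pair_mul]
      · rw [levelSign_conj 1 hu hca, levelSign_conj 2 hu hca, e1]
      · rw [levelSign_conj 1 hv hac, levelSign_conj 2 hv hac, e2]
    · refine ⟨u * (σa * σc) * u⁻¹, mul_mem (mul_mem hu hac) (inv_mem hu),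
        v * (σc * σa) * v⁻¹, mul_mem (mul_mem hv hca) (inv_mem hv), ?_, ?_, ?_⟩
      · rw [ab_sq_eq, mul_inv_rev, pair_inv, State.perm_inv, mul_assoc, mul_assoc, a_mul_pair_mul,
          a_mul_a_mul, pair_mul, pair_mul]
        simp only [mul_assoc]
      · rw [levelSign_conj 1 hu hac, levelSign_conj 2 hu hac, e2]
      · rw [levelSign_conj 1 hv hca, levelSign_conj 2 hv hca, e1]
  | one => exact ⟨1, one_mem _, 1, one_mem _, by simp, by simp [levelSign_one],
      by simp [levelSign_one]⟩
  | mul x y hx hy ihx ihy =>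
    obtain ⟨u, hu, v, hv, rfl, h1, h2⟩ := ihx
    obtain ⟨u', hu', v', hv', rfl, h1', h2'⟩ := ihy
    refine ⟨_, mul_mem hu hu', _, mul_mem hv hv', pair_mul _ _ _ _, ?_, ?_⟩
    · rw [levelSign_mul 1 hu hu', levelSign_mul 2 hu hu', mul_mul_mul_comm, h1, h1', one_mul]
    · rw [levelSign_mul 1 hv hv', levelSign_mul 2 hv hv', mul_mul_mul_comm, h2, h2', one_mul]
  | inv x hx ih =>
    obtain ⟨u, hu, v, hv, rfl, h1, h2⟩ := ih
    refine ⟨_, inv_mem hu, _, inv_mem hv, pair_inv _ _, ?_, ?_⟩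
    · rw [levelSign_inv 1 hu, levelSign_inv 2 hu, h1]
    · rw [levelSign_inv 1 hv, levelSign_inv 2 hv, h2]

/-- The elements of the Grigorchuk group commuting with `b` modulo `K`. -/
def bCentralizerMod : Subgroup (Perm (List Bool)) where
  carrier := {x | x ∈ grigorchukGroup ∧ σb * x * σb⁻¹ * x⁻¹ ∈ kSubgroup}
  one_mem' := ⟨one_mem _, by simp [one_mem]⟩
  mul_mem' := by
    rintro x y ⟨hx, hx'⟩ ⟨hy, hy'⟩
    refine ⟨mul_mem hx hy, ?_⟩
    convert mul_mem hx' (isNormalIn_kSubgroup.conj_mem x hx _ hy') using 1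
    group
  inv_mem' := by
    rintro x ⟨hx, hx'⟩
    refine ⟨inv_mem hx, ?_⟩
    convert isNormalIn_kSubgroup.conj_mem' hx (inv_mem hx') using 1
    group

theorem a_mem_bCentralizerMod : σa ∈ bCentralizerMod := by
  refine ⟨a_mem, ?_⟩
  convert inv_mem ab_sq_mem_kSubgroup using 1
  simp [pow_two, State.perm_inv, mul_assoc]

theorem d_mem_bCentralizerMod : σd ∈ bCentralizerMod := by
  refine ⟨d_mem, ?_⟩
  rw [State.perm_inv, State.perm_inv, bd_mul, cb_mul, State.perm_mul_self]
  exact one_mem _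

/-- Modulo K, b commutes with a and d, and (ad)⁴ = 1 makes ⟨a, d⟩ dihedral, so every word can be
sorted. -/
theorem exists_normal_form {g : Perm (List Bool)} (hg : g ∈ grigorchukGroup) :
    ∃ j i l : ℕ, ∃ k ∈ kSubgroup, g = (σa * σd) ^ j * σa ^ i * σb ^ l * k := by
  set S : Set (Perm (List Bool)) :=
    {g | ∃ j i l : ℕ, ∃ k ∈ kSubgroup, g = (σa * σd) ^ j * σa ^ i * σb ^ l * k} with hS
  have h4 : (σa * σd) ^ 4 = 1 := by
    rw [show 4 = 2 * 2 from rfl, pow_mul, ad_sq_eq, pair_pow, pow_two, State.perm_mul_self,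
      pair_one_one]
  have hr : σa * (σa * σd) * σa⁻¹ = (σa * σd) ^ 3 := by
    have : (σa * σd) ^ 3 = (σa * σd)⁻¹ := by
      rw [eq_inv_iff_mul_eq_one, ← pow_succ, h4]
    rw [this, mul_inv_rev, State.perm_inv, State.perm_inv, a_mul_a_mul]
  have ha : ∀ g ∈ S, σa * g ∈ S := by
    rintro _ ⟨j, i, l, k, hk, rfl⟩
    -- Conjugation by a inverts ad; the inverse is written as a cube to keep exponents natural.
    refine ⟨3 * j, i + 1, l, k, hk, ?_⟩
    rw [pow_mul, ← hr, conj_pow, pow_succ']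
    group
  have hb : ∀ g ∈ S, σb * g ∈ S := by
    rintro _ ⟨j, i, l, k, hk, rfl⟩
    have hx : (σa * σd) ^ j * σa ^ i ∈ bCentralizerMod :=
      mul_mem (pow_mem (mul_mem a_mem_bCentralizerMod d_mem_bCentralizerMod) _)
        (pow_mem a_mem_bCentralizerMod _)
    set x := (σa * σd) ^ j * σa ^ i with hxdef
    refine ⟨j, i, l + 1, _, mul_mem (isNormalIn_kSubgroup.conj_mem'
      (mul_mem hx.1 (pow_mem b_mem (l + 1))) hx.2) hk, ?_⟩
    rw [← hxdef, pow_succ']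
    group
  have hd : ∀ g ∈ S, σd * g ∈ S := by
    intro g hg
    have : σd * g = σa * ((σa * σd) * g) := by rw [mul_assoc, a_mul_a_mul]
    rw [this]
    refine ha _ ?_
    obtain ⟨j, i, l, k, hk, rfl⟩ := hg
    exact ⟨j + 1, i, l, k, hk, by rw [pow_succ']; simp only [mul_assoc]⟩
  have hc : ∀ g ∈ S, σc * g ∈ S := by
    intro g hg
    rw [← bd_mul, mul_assoc]
    exact hb _ (hd _ hg)
  change g ∈ S
  induction hg using Subgroup.closure_induction_left with
  | one => exact ⟨0, 0, 0, 1, one_mem _, by simp⟩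
  | mul_left x hx y hy ih =>
    rcases hx with rfl | rfl | rfl | rfl
    exacts [ha _ ih, hb _ ih, hc _ ih, hd _ ih]
  | inv_mul_cancel x hx y hy ih =>
    rcases hx with rfl | rfl | rfl | rfl <;> rw [State.perm_inv]
    exacts [ha _ ih, hb _ ih, hc _ ih, hd _ ih]

theorem isCongruence_kSubgroup : IsCongruence kSubgroup := by
  refine ⟨3, fun g hgs => ?_⟩
  have hg := hgs.1
  have hs : g ∈ levelStab 3 := hgs.2
  clear hgs
  obtain ⟨j, i, l, k, hk, rfl⟩ := exists_normal_form hg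
  have had := mul_mem a_mem d_mem
  have hsign : ∀ n ≤ 3, levelSign n (σa * σd) ^ j * levelSign n σa ^ i * levelSign n σb ^ l = 1 := by
    intro n hn
    have h := levelSign_eq_one_of_mem_levelStab (n := n) hg fun w hw => hs w (hw.trans hn)
    rwa [levelSign_mul n (mul_mem (mul_mem (pow_mem had _) (pow_mem a_mem _)) (pow_mem b_mem _))
      (isNormalIn_kSubgroup.le hk), levelSign_mul n (mul_mem (pow_mem had _) (pow_mem a_mem _))
      (pow_mem b_mem _), levelSign_mul n (pow_mem had _) (pow_mem a_mem _), levelSign_kSubgroup n hk,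
      levelSign_pow n had, levelSign_pow n a_mem, levelSign_pow n b_mem, mul_one] at h
  have h1 := hsign 1 (by norm_num)
  have h2 := hsign 2 (by norm_num)
  have h3 := hsign 3 (by norm_num)
  rw [levelSign_mul _ a_mem d_mem] at h1 h2 h3
  rw [levelSign_one_a, levelSign_one_b, levelSign_one_d] at h1
  rw [levelSign_two_a, levelSign_two_b, levelSign_two_d] at h2
  rw [levelSign_three_a, levelSign_three_b, levelSign_three_d] at h3
  -- The signs on levels 2, 3, 1 make l, then j, then i even, which leaves a power of (b, b) times
  -- k.
  have hl : Even l := by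
    rcases Nat.even_or_odd l with h | h
    · exact h
    · simp [h.neg_one_pow] at h2
  have hj : Even j := by
    rcases Nat.even_or_odd j with h | h
    · exact h
    · simp [h.neg_one_pow, hl.neg_one_pow] at h3
  have hi : Even i := by
    rcases Nat.even_or_odd i with h | h
    · exact h
    · simp [h.neg_one_pow, hj.neg_one_pow] at h1
  obtain ⟨l, rfl⟩ := hl.two_dvd
  obtain ⟨i, rfl⟩ := hi.two_dvd
  obtain ⟨j, rfl⟩ := hj.two_dvd
  rw [pow_mul, pow_mul, pow_mul, pow_two σa, pow_two σb, State.perm_mul_self, State.perm_mul_self,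
    one_pow, one_pow, mul_one, mul_one, ad_sq_eq, pair_pow] at hs ⊢
  rcases Nat.even_or_odd j with h | h
  · obtain ⟨m, rfl⟩ := h.two_dvd
    rwa [pow_mul, pow_two, State.perm_mul_self, one_pow, pair_one_one, one_mul]
  · obtain ⟨m, rfl⟩ := h
    rw [pow_succ, pow_mul, pow_two, State.perm_mul_self, one_pow, one_mul] at hs
    -- Now bu fixes level 2, so u has sign 1 on level 1 and -1 on level 2, against the parity of
    -- sections of K.
    obtain ⟨u, hu, v, hv, rfl, h1, h2⟩ := kSubgroup_sections hk
    rw [pair_mul, pair_mem_levelStab] at hs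
    have e2 := levelSign_eq_one_of_mem_levelStab (n := 2) (mul_mem b_mem hu) hs.1
    have e1 := levelSign_eq_one_of_mem_levelStab (n := 1) (mul_mem b_mem hu)
      fun w hw => hs.1 w (hw.trans (by norm_num))
    rw [levelSign_mul _ b_mem hu, levelSign_one_b, one_mul] at e1
    rw [levelSign_mul _ b_mem hu, levelSign_two_b] at e2
    rw [e1, one_mul] at h1
    rw [h1] at e2
    exact absurd e2 (by decide)

/-! ### Nontrivial normal subgroups -/

/-- The elements that centralize `K` modulo the normal subgroup `N`. -/
def kCentralizerMod {N : Subgroup (Perm (List Bool))} (hN : IsNormalIn N) :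
    Subgroup (Perm (List Bool)) where
  carrier := {e | e ∈ grigorchukGroup ∧ ∀ k ∈ kSubgroup, k * e * k⁻¹ * e⁻¹ ∈ N}
  one_mem' := ⟨one_mem _, by simp [one_mem]⟩
  mul_mem' := by
    rintro x y ⟨hx, hx'⟩ ⟨hy, hy'⟩
    refine ⟨mul_mem hx hy, fun k hk => ?_⟩
    convert mul_mem (hx' k hk) (hN.conj_mem x hx _ (hy' k hk)) using 1
    group
  inv_mem' := by
    rintro x ⟨hx, hx'⟩
    refine ⟨inv_mem hx, fun k hk => ?_⟩
    convert hN.conj_mem' hx (inv_mem (hx' k hk)) using 1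
    group

/-- K contains (k, 1), whose commutator with (f, g) is ([k, f], 1). -/
theorem mem_kCentralizerMod_rigidPart {N : Subgroup (Perm (List Bool))} (hN : IsNormalIn N)
    {f g : Perm (List Bool)} (h : pair f g ∈ kCentralizerMod hN) :
    f ∈ kCentralizerMod hN.rigidPart := by
  have hf := (mem_of_pair_mem h.1).1
  refine ⟨hf, fun k hk => ⟨?_, ?_⟩⟩
  · have hk' := isNormalIn_kSubgroup.le hk
    exact mul_mem (mul_mem (mul_mem hk' hf) (inv_mem hk')) (inv_mem hf)
  · simpa [pair_mul, pair_inv] using h.2 _ (pair_one_mem_kSubgroup hk)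

theorem kSubgroup_le_kCentralizerMod_rigidPart {N : Subgroup (Perm (List Bool))}
    (hN : IsNormalIn N) (h : kSubgroup ≤ kCentralizerMod hN) :
    kSubgroup ≤ kCentralizerMod hN.rigidPart := fun _ hk =>
  mem_kCentralizerMod_rigidPart hN (h (pair_one_mem_kSubgroup hk))

/-- Sections recover the generators: (ab)² has the section ca, (ca)² has ad, (ad)² has b, and b has
a. At depth four the whole group centralizes K modulo the rigid part, and the commutator of
`pair_ab_sq_one` then puts K into the rigid part at depth five. -/
theorem IsNormalIn.isCongruence_of_commutator_kSubgroup {N : Subgroup (Perm (List Bool))}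
    (hN : IsNormalIn N) (h : kSubgroup ≤ kCentralizerMod hN) : IsCongruence N := by
  have hca : ∀ {N : Subgroup (Perm (List Bool))} (hN : IsNormalIn N),
      kSubgroup ≤ kCentralizerMod hN → σc * σa ∈ kCentralizerMod hN.rigidPart := fun hN h =>
    mem_kCentralizerMod_rigidPart hN (ab_sq_eq ▸ h ab_sq_mem_kSubgroup)
  have h1 := kSubgroup_le_kCentralizerMod_rigidPart hN h
  have h2 := kSubgroup_le_kCentralizerMod_rigidPart hN.rigidPart h1
  have h3 := kSubgroup_le_kCentralizerMod_rigidPart hN.rigidPart.rigidPart h2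
  have ca1 := hca hN h
  have ca2 := hca _ h1
  have ca3 := hca _ h2
  have ca4 := hca _ h3
  have had : ∀ {N : Subgroup (Perm (List Bool))} (hN : IsNormalIn N),
      σc * σa ∈ kCentralizerMod hN → σa * σd ∈ kCentralizerMod hN.rigidPart := fun hN h =>
    mem_kCentralizerMod_rigidPart hN (ca_sq_eq ▸ pow_mem h 2)
  have ad2 := had _ ca1
  have ad4 := had _ ca3
  have b3 : σb ∈ kCentralizerMod hN.rigidPart.rigidPart.rigidPart :=
    mem_kCentralizerMod_rigidPart _ (ad_sq_eq ▸ pow_mem ad2 2)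
  have a4 : σa ∈ kCentralizerMod hN.rigidPart.rigidPart.rigidPart.rigidPart :=
    mem_kCentralizerMod_rigidPart _ (b_perm ▸ b3)
  have c4 := mul_mem ca4 a4
  rw [mul_assoc, State.perm_mul_self, mul_one] at c4
  have d4 := mul_mem a4 ad4
  rw [a_mul_a_mul] at d4
  have b4 := mul_mem c4 d4
  rw [cd_mul] at b4
  have top := grigorchukGroup_le a4 b4 c4 d4
  have k5 : kSubgroup ≤
      Grigorchuk.rigidPart (Grigorchuk.rigidPart (Grigorchuk.rigidPart
        (Grigorchuk.rigidPart (Grigorchuk.rigidPart N)))) := by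
    refine hN.rigidPart.rigidPart.rigidPart.rigidPart.rigidPart.kSubgroup_le
      ⟨ab_sq_mem_grigorchukGroup, ?_⟩
    have := (top pair_b_one_mem).2 _ (inv_mem ab_sq_mem_kSubgroup)
    rw [pair_ab_sq_one]
    simpa only [inv_inv, mul_assoc] using this
  obtain ⟨m, hm⟩ := isCongruence_kSubgroup
  exact hN.isCongruence <| hN.rigidPart.isCongruence <| hN.rigidPart.rigidPart.isCongruence <|
    hN.rigidPart.rigidPart.rigidPart.isCongruence <|
    hN.rigidPart.rigidPart.rigidPart.rigidPart.isCongruence ⟨m, hm.trans k5⟩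

/-- The permutation that acts as `k` on the subtree below `v` and trivially outside. -/
def rigidAt : List Bool → Perm (List Bool) → Perm (List Bool)
  | [], k => k
  | false :: v, k => pair (rigidAt v k) 1
  | true :: v, k => pair 1 (rigidAt v k)

theorem rigidAt_mul (v : List Bool) (k l : Perm (List Bool)) :
    rigidAt v (k * l) = rigidAt v k * rigidAt v l := by
  induction v with
  | nil => rfl
  | cons x v ih => cases x <;> simp [rigidAt, ih, pair_mul]

theorem rigidAt_inv (v : List Bool) (k : Perm (List Bool)) :
    rigidAt v k⁻¹ = (rigidAt v k)⁻¹ := by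
  induction v with
  | nil => rfl
  | cons x v ih => cases x <;> simp [rigidAt, ih, pair_inv]

theorem rigidAt_injective (v : List Bool) : Function.Injective (rigidAt v) := by
  intro k l h
  induction v with
  | nil => exact h
  | cons x v ih =>
    cases x
    · exact ih (pair_inj.1 h).1
    · exact ih (pair_inj.1 h).2

theorem rigidAt_apply_of_not_prefix {v : List Bool} {k : Perm (List Bool)} {w : List Bool}
    (h : ¬ v <+: w) : rigidAt v k w = w := by
  induction v generalizing w with
  | nil => exact absurd (List.nil_prefix) h
  | cons x v ih =>
    rcases w with _ | ⟨y, w⟩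
    · cases x <;> rfl
    · rw [List.cons_prefix_cons, not_and] at h
      cases x <;> cases y <;> simp [rigidAt]
      · exact ih (h rfl)
      · exact ih (h rfl)

theorem rigidAt_mem_kSubgroup (v : List Bool) {k : Perm (List Bool)} (hk : k ∈ kSubgroup) :
    rigidAt v k ∈ kSubgroup := by
  induction v with
  | nil => exact hk
  | cons x v ih =>
    cases x
    · exact pair_one_mem_kSubgroup ih
    · exact isNormalIn_kSubgroup.pair_swap_mem (pair_one_mem_kSubgroup ih)

theorem rigidAt_mem_levelStab (v : List Bool) {k : Perm (List Bool)} (hk : k ∈ levelStab 0) :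
    rigidAt v k ∈ levelStab v.length := by
  induction v with
  | nil => exact hk
  | cons x v ih => cases x <;> exact pair_mem_levelStab.2 (by simp [ih, one_mem])

/-- The conjugate is supported below n v, a vertex different from v on the same level. -/
theorem disjoint_conj_rigidAt {n : Perm (List Bool)} (hn : n ∈ treeAut) {v : List Bool}
    (hv : n v ≠ v) (k l : Perm (List Bool)) :
    Perm.Disjoint (n * rigidAt v k * n⁻¹) (rigidAt v l) := by
  intro w
  by_cases hw : v <+: w
  · left
    have : ¬ v <+: n⁻¹ w := by
      intro h
      apply hv
      have h1 := (hn (n⁻¹ w)).2 v.length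
      rw [← List.prefix_iff_eq_take.1 h, show n (n⁻¹ w) = w by simp,
        ← List.prefix_iff_eq_take.1 hw] at h1
      exact h1.symm
    rw [Perm.mul_apply, Perm.mul_apply, rigidAt_apply_of_not_prefix this]
    simp
  · exact Or.inr (rigidAt_apply_of_not_prefix hw)

/-- With κ, μ the copies of k, l at v, N contains [[κ, n], μ]. Here [κ, n] = κ(nκn⁻¹)⁻¹ and the
second factor commutes with μ, so this is [κ, μ]. -/
theorem IsNormalIn.rigidAt_commutator_mem {N : Subgroup (Perm (List Bool))} (hN : IsNormalIn N)
    {n : Perm (List Bool)} (hn : n ∈ N) {v : List Bool} (hv : n v ≠ v) {k l : Perm (List Bool)}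
    (hk : k ∈ kSubgroup) (hl : l ∈ kSubgroup) : rigidAt v (k * l * k⁻¹ * l⁻¹) ∈ N := by
  have hk' := isNormalIn_kSubgroup.le (rigidAt_mem_kSubgroup v hk)
  have hl' := isNormalIn_kSubgroup.le (rigidAt_mem_kSubgroup v hl)
  have hc := (disjoint_conj_rigidAt (le_treeAut (hN.le hn)) hv k l).commute
  rw [rigidAt_mul, rigidAt_mul, rigidAt_mul, rigidAt_inv, rigidAt_inv]
  set κ := rigidAt v k
  set μ := rigidAt v l
  have hp : κ * n * κ⁻¹ * n⁻¹ ∈ N := mul_mem (hN.conj_mem κ hk' n hn) (inv_mem hn)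
  convert mul_mem hp (hN.conj_mem μ hl' _ (inv_mem hp)) using 1
  have h2 : (n * κ * n⁻¹)⁻¹ * μ * (n * κ * n⁻¹) = μ := by
    rw [mul_assoc, ← hc.eq, inv_mul_cancel_left]
  calc κ * μ * κ⁻¹ * μ⁻¹ = κ * ((n * κ * n⁻¹)⁻¹ * μ * (n * κ * n⁻¹)) * κ⁻¹ * μ⁻¹ := by rw [h2]
    _ = _ := by group

theorem IsNormalIn.isCongruence_of_rigidAt_commutator (v : List Bool)
    {N : Subgroup (Perm (List Bool))} (hN : IsNormalIn N)
    (h : ∀ k ∈ kSubgroup, ∀ l ∈ kSubgroup, rigidAt v (k * l * k⁻¹ * l⁻¹) ∈ N) :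
    IsCongruence N := by
  induction v generalizing N with
  | nil =>
    exact hN.isCongruence_of_commutator_kSubgroup fun l hl =>
      ⟨isNormalIn_kSubgroup.le hl, fun k hk => h k hk l hl⟩
  | cons x v ih =>
    refine hN.isCongruence (ih hN.rigidPart fun k hk l hl =>
      ⟨isNormalIn_kSubgroup.le (rigidAt_mem_kSubgroup v ?_), ?_⟩)
    · exact mul_mem (mul_mem (mul_mem hk hl) (inv_mem hk)) (inv_mem hl)
    · cases x
      · exact h k hk l hl
      · exact hN.pair_swap_mem (h k hk l hl)

/-- A nontrivial normal subgroup of the Grigorchuk group contains a level stabilizer. -/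
theorem IsNormalIn.isCongruence_of_ne_one {N : Subgroup (Perm (List Bool))} (hN : IsNormalIn N)
    {n : Perm (List Bool)} (hn : n ∈ N) (h1 : n ≠ 1) : IsCongruence N := by
  obtain ⟨v, hv⟩ : ∃ v, n v ≠ v := by
    by_contra! h
    exact h1 (Equiv.ext h)
  exact hN.isCongruence_of_rigidAt_commutator v fun k hk l hl =>
    hN.rigidAt_commutator_mem hn hv hk hl

theorem ab_sq_not_commute :
    (σa * σb) ^ 2 * pair ((σa * σb) ^ 2) 1 ≠ pair ((σa * σb) ^ 2) 1 * (σa * σb) ^ 2 := by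
  intro h
  have := DFunLike.congr_fun h [false, false, false, false, false, false]
  revert this
  decide

theorem IsCongruence.exists_not_commute {N : Subgroup (Perm (List Bool))} (hN : IsCongruence N) :
    ∃ x ∈ N, ∃ y ∈ N, x * y ≠ y * x := by
  obtain ⟨m, hm⟩ := hN
  have key : ∀ k ∈ kSubgroup, rigidAt (List.replicate m false) k ∈ N := by
    intro k hk
    have h1 := isNormalIn_kSubgroup.le (rigidAt_mem_kSubgroup (List.replicate m false) hk)
    refine hm ⟨h1, ?_⟩
    have := rigidAt_mem_levelStab (List.replicate m false) (k := k)
      (by simpa using pow_mem_levelStab (isNormalIn_kSubgroup.le hk) 0)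
    simpa using this
  refine ⟨_, key _ ab_sq_mem_kSubgroup, _, key _ (pair_one_mem_kSubgroup ab_sq_mem_kSubgroup), ?_⟩
  rw [← rigidAt_mul, ← rigidAt_mul]
  exact fun h => ab_sq_not_commute (rigidAt_injective _ h)

/-! ### Finite quotients -/

/-- The action of the Grigorchuk group on the vertices of level at most `m`. -/
def levelHom (m : ℕ) : grigorchukGroup →* Perm {w : List Bool // w.length ≤ m} where
  toFun g := (g : Perm (List Bool)).subtypePerm fun w => by rw [(le_treeAut g.2 w).1]
  map_one' := rfl
  map_mul' _ _ := rfl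

instance (m : ℕ) : Finite {w : List Bool // w.length ≤ m} :=
  (List.finite_length_le Bool m).to_subtype

theorem mem_ker_levelHom {m : ℕ} {g : grigorchukGroup} :
    g ∈ (levelHom m).ker ↔ (g : Perm (List Bool)) ∈ levelStab m := by
  rw [MonoidHom.mem_ker, Equiv.ext_iff]
  refine ⟨fun h w hw => congrArg Subtype.val (h ⟨w, hw⟩), fun h w => Subtype.ext (h _ w.2)⟩

theorem isPGroup_range_levelHom (m : ℕ) : IsPGroup 2 (levelHom m).range := by
  rintro ⟨_, g, rfl⟩
  refine ⟨m, Subtype.ext ?_⟩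
  change (levelHom m g) ^ 2 ^ m = 1
  rw [← map_pow, ← MonoidHom.mem_ker, mem_ker_levelHom]
  exact pow_mem_levelStab g.2 m

theorem residuallyFinite : Group.ResiduallyFinite grigorchukGroup := by
  rw [Group.residuallyFinite_iff_forall_finiteIndex]
  intro g hg
  refine Subtype.ext (Equiv.ext fun w => ?_)
  have := hg (levelHom w.length).ker
  exact mem_ker_levelHom.1 this w le_rfl

/-- A subgroup of the Grigorchuk group that contains a level stabilizer and conjugates of all
the elements of a generating set is the whole group. -/
theorem IsCongruence.grigorchukGroup_le {H : Subgroup (Perm (List Bool))} (hH : IsCongruence H)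
    {S : Set (Perm (List Bool))} (hS : grigorchukGroup ≤ Subgroup.closure S)
    (hSG : S ⊆ grigorchukGroup)
    (h : ∀ s ∈ S, ∃ g ∈ grigorchukGroup, g⁻¹ * s * g ∈ H) : grigorchukGroup ≤ H := by
  obtain ⟨m, hm⟩ := hH
  set H' := H.subgroupOf grigorchukGroup with hH'
  set φ := (levelHom m).rangeRestrict with hφ
  have hφs : Function.Surjective φ := MonoidHom.rangeRestrict_surjective _
  have hker : φ.ker ≤ H' := by
    intro g hg
    rw [hφ, MonoidHom.ker_rangeRestrict, mem_ker_levelHom] at hg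
    exact hm ⟨g.2, hg⟩
  have hnil : Group.IsNilpotent (levelHom m).range := (isPGroup_range_levelHom m).isNilpotent
  -- Otherwise the image lies in a maximal subgroup, normal by nilpotency; it absorbs conjugates, so
  -- it contains the image of S and is everything.
  have htop : H'.map φ = ⊤ := by
    by_contra hne
    obtain ⟨M, hM, hHM⟩ := (eq_top_or_exists_le_coatom (H'.map φ)).resolve_left hne
    have hMn : M.Normal :=
      Subgroup.NormalizerCondition.normal_of_coatom _ Group.normalizerCondition_of_isNilpotent hM
    apply hM.1
    have hMn' : (M.comap φ).Normal := hMn.comap φ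
    have hle : grigorchukGroup ≤ (M.comap φ).map grigorchukGroup.subtype := by
      refine hS.trans ((Subgroup.closure_le _).2 fun s hs => ?_)
      obtain ⟨g, hg, hgs⟩ := h s hs
      refine ⟨⟨s, hSG hs⟩, ?_, rfl⟩
      have h1 : (⟨g, hg⟩ : grigorchukGroup)⁻¹ * ⟨s, hSG hs⟩ * ⟨g, hg⟩ ∈ M.comap φ :=
        Subgroup.map_le_iff_le_comap.1 hHM hgs
      have h2 := hMn'.conj_mem _ h1 ⟨g, hg⟩
      rwa [show (⟨g, hg⟩ : grigorchukGroup) * (⟨g, hg⟩⁻¹ * ⟨s, hSG hs⟩ * ⟨g, hg⟩) * ⟨g, hg⟩⁻¹ =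
        ⟨s, hSG hs⟩ by group] at h2
    rw [eq_top_iff]
    intro y _
    obtain ⟨g, rfl⟩ := hφs y
    obtain ⟨g', hg', hgg⟩ := hle g.2
    rw [show g = g' from Subtype.ext hgg.symm]
    exact hg'
  intro g hg
  have : φ ⟨g, hg⟩ ∈ H'.map φ := htop ▸ Subgroup.mem_top _
  obtain ⟨h', hh', he⟩ := this
  have h3 : h'⁻¹ * ⟨g, hg⟩ ∈ φ.ker := by rw [MonoidHom.mem_ker, map_mul, map_inv, he]; simp
  have h4 := mul_mem hh' (hker h3)
  rw [mul_inv_cancel_left] at h4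
  exact h4

/-! ### The Grigorchuk group is not virtually solvable -/

theorem isNormalIn_map_subtype (N : Subgroup grigorchukGroup) [hN : N.Normal] :
    IsNormalIn (N.map grigorchukGroup.subtype) where
  le := Subgroup.map_subtype_le N
  conj_mem := by
    rintro g hg _ ⟨n, hn, rfl⟩
    exact ⟨_, hN.conj_mem n hn ⟨g, hg⟩, rfl⟩

theorem commutator_ne_bot {N : Subgroup grigorchukGroup} [N.Normal] (h : N ≠ ⊥) : ⁅N, N⁆ ≠ ⊥ := by
  obtain ⟨n, hn, h1⟩ := N.bot_or_exists_ne_one.resolve_left h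
  have hc := (isNormalIn_map_subtype N).isCongruence_of_ne_one (n := n) ⟨n, hn, rfl⟩
    fun e => h1 (Subtype.ext e)
  obtain ⟨_, ⟨x, hx, rfl⟩, _, ⟨y, hy, rfl⟩, hxy⟩ := hc.exists_not_commute
  intro hbot
  have := Subgroup.commutator_mem_commutator hx hy
  rw [hbot, Subgroup.mem_bot, commutatorElement_eq_one_iff_mul_comm] at this
  exact hxy (congrArg Subtype.val this)

instance : Infinite grigorchukGroup := by
  have hinf : Infinite kSubgroup := by
    -- The injection k ↦ (k, 1) of K into itself misses (ab)² = (ca, ac).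
    refine Infinite.of_injective_to_set (s := {⟨_, ab_sq_mem_kSubgroup⟩}ᶜ)
      (fun h => by have := h ▸ Set.mem_univ (⟨_, ab_sq_mem_kSubgroup⟩ : kSubgroup); simp at this)
      (f := fun k => ⟨⟨_, pair_one_mem_kSubgroup k.2⟩, ?_⟩) ?_
    · intro h
      have h := congrArg Subtype.val h
      simp only [ab_sq_eq, pair_inj] at h
      have := DFunLike.congr_fun h.2.symm [false]
      simp [State.act, State.output] at this
    · intro k l h
      have := congrArg (fun x => (x.1 : Perm (List Bool))) h
      exact Subtype.ext (pair_inj.1 this).1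
  exact Infinite.of_injective _ (Subgroup.inclusion_injective isNormalIn_kSubgroup.le)

theorem not_isVirtuallySolvable : ¬ IsVirtuallySolvable grigorchukGroup := by
  rintro ⟨H, hH, hs⟩
  have hle := H.normalCore_le
  set N := H.normalCore
  have hN : N ≠ ⊥ := by
    intro h
    have : N.FiniteIndex := inferInstance
    rw [h] at this
    have : Finite grigorchukGroup :=
      Nat.finite_of_card_ne_zero (by rw [← Subgroup.index_bot]; exact this.index_ne_zero)
    exact not_finite grigorchukGroup
  have hNs : Group.IsSolvable N :=
    Group.isSolvable_of_isSolvable_injective (Subgroup.inclusion_injective hle)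
  obtain ⟨n, hn⟩ := hNs.solvable
  have key : ∀ n, (derivedSeries N n).map N.subtype ≠ ⊥ := by
    intro n
    induction n with
    | zero => rwa [derivedSeries_zero, ← MonoidHom.range_eq_map, Subgroup.range_subtype]
    | succ n ih =>
      rw [derivedSeries_succ, Subgroup.map_commutator]
      exact commutator_ne_bot ih
  exact key n (by rw [hn, Subgroup.map_bot])

/-! ### The letters `b`, `c`, `d` -/

/-- The generators `b`, `c`, `d`. -/
inductive Letter where
  | b | c | d

namespace Letter

/-- The permutation of the tree given by a letter. -/
def perm : Letter → Perm (List Bool)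
  | b => State.perm State.b
  | c => State.perm State.c
  | d => State.perm State.d

/-- The section at `1` of a letter. -/
def next : Letter → Letter
  | b => c
  | c => d
  | d => b

/-- The section at `0` of a letter. -/
def top : Letter → Perm (List Bool)
  | b => State.perm State.a
  | c => State.perm State.a
  | d => 1

/-- The weight of a letter. -/
def weight : Letter → ℕ
  | b => 12
  | c => 11
  | d => 10

theorem perm_eq (x : Letter) : x.perm = pair x.top x.next.perm := by
  cases x
  exacts [b_perm, c_perm, d_perm]

theorem perm_mem (x : Letter) : x.perm ∈ grigorchukGroup := by
  cases x
  exacts [b_mem, c_mem, d_mem]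

theorem perm_mul_self (x : Letter) : x.perm * x.perm = 1 := by
  cases x <;> exact State.perm_mul_self _

theorem perm_inv (x : Letter) : x.perm⁻¹ = x.perm := inv_eq_of_mul_eq_one_left x.perm_mul_self

theorem top_eq_a {x : Letter} (hx : x ≠ d) : x.top = σa := by
  cases x <;> first | rfl | exact absurd rfl hx

theorem next_ne {x y : Letter} (h : x ≠ y) : x.next ≠ y.next := by
  cases x <;> cases y <;> simp_all [next]

theorem perm_mul_comm (x y : Letter) : x.perm * y.perm = y.perm * x.perm := by
  cases x <;> cases y <;>
    simp [perm, bc_mul, cb_mul, bd_mul, db_mul, cd_mul, dc_mul]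

theorem perm_mul_cases (x y : Letter) : x.perm * y.perm = 1 ∨
    ∃ z : Letter, x.perm * y.perm = z.perm ∧ z.weight < x.weight + y.weight := by
  cases x <;> cases y
  exacts [.inl (perm_mul_self _), .inr ⟨d, bc_mul, by decide⟩, .inr ⟨c, bd_mul, by decide⟩,
    .inr ⟨d, cb_mul, by decide⟩, .inl (perm_mul_self _), .inr ⟨b, cd_mul, by decide⟩,
    .inr ⟨c, db_mul, by decide⟩, .inr ⟨b, dc_mul, by decide⟩, .inl (perm_mul_self _)]

theorem exists_levelSign_ne_one (x : Letter) : ∃ n, levelSign n x.perm ≠ 1 := by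
  cases x
  · exact ⟨2, by rw [perm, levelSign_two_b]; decide⟩
  · exact ⟨2, by rw [perm, levelSign_two_c]; decide⟩
  · exact ⟨3, by rw [perm, levelSign_three_d]; decide⟩

theorem exists_levelSign_mul_ne_one {x y : Letter} (h : x ≠ y) :
    ∃ n, levelSign n (x.perm * y.perm) ≠ 1 := by
  cases x <;> cases y <;> first | exact absurd rfl h | skip
  · exact ⟨3, by rw [perm, perm, bc_mul, levelSign_three_d]; decide⟩
  · exact ⟨2, by rw [perm, perm, bd_mul, levelSign_two_c]; decide⟩
  · exact ⟨3, by rw [perm, perm, cb_mul, levelSign_three_d]; decide⟩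
  · exact ⟨2, by rw [perm, perm, cd_mul, levelSign_two_b]; decide⟩
  · exact ⟨2, by rw [perm, perm, db_mul, levelSign_two_c]; decide⟩
  · exact ⟨2, by rw [perm, perm, dc_mul, levelSign_two_b]; decide⟩

theorem grigorchukGroup_le_closure {x y : Letter} (h : x ≠ y) :
    grigorchukGroup ≤ Subgroup.closure {State.perm State.a, x.perm, y.perm} := by
  set C := Subgroup.closure {State.perm State.a, x.perm, y.perm}
  have ha : State.perm State.a ∈ C := Subgroup.subset_closure (by simp)
  have hx : x.perm ∈ C := Subgroup.subset_closure (by simp)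
  have hy : y.perm ∈ C := Subgroup.subset_closure (by simp)
  have hxy := mul_mem hx hy
  clear_value C
  cases x <;> cases y <;> first | exact absurd rfl h | skip
  all_goals
    simp only [perm, bc_mul, cb_mul, bd_mul, db_mul, cd_mul, dc_mul] at hx hy hxy
    apply grigorchukGroup_le <;> assumption

end Letter

theorem a_conj_pair_of_eq {t t₀ t₁ : Perm (List Bool)} (ht : t = pair t₀ t₁ * σa)
    (u v : Perm (List Bool)) :
    t⁻¹ * pair u v * t = pair (t₁⁻¹ * v * t₁) (t₀⁻¹ * u * t₀) := by
  rw [ht, mul_inv_rev, pair_inv, State.perm_inv]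
  simp only [mul_assoc, pair_mul_mul, a_mul_pair_mul, State.perm_mul_self, mul_one,
    pair_mul]

/-! ### Subgroups with a full section -/

/-- Conjugating (n, 1) by (g, v) ∈ H conjugates n by g, whatever v is. -/
theorem isNormalIn_rigidPart_of_section {H : Subgroup (Perm (List Bool))}
    (hs : grigorchukGroup ≤ sectionSubgroup H) : IsNormalIn (rigidPart H) where
  le := fun _ h => h.1
  conj_mem g hg n hn := by
    obtain ⟨v, hv⟩ := hs hg
    refine ⟨mul_mem (mul_mem hg hn.1) (inv_mem hg), ?_⟩
    simpa [pair_mul, pair_inv] using mul_mem (mul_mem hv hn.2) (inv_mem hv)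

section FullSection

variable {H : Subgroup (Perm (List Bool))} (hH : H ≤ grigorchukGroup)
  (hs : grigorchukGroup ≤ sectionSubgroup H) {t t₀ t₁ : Perm (List Bool)} (ht : t ∈ H)
  (hte : t = pair t₀ t₁ * State.perm State.a)

include hH hs ht hte

/-- If needed, t moves the top section to 0; an element of H with prescribed section at 0 then
removes its conjugator. With first entries exactly `x.top`, the pairs of two letters can be divided.
-/
theorem exists_pair_top_mem {x : Letter} {p : Perm (List Bool)} (hp : p ∈ grigorchukGroup)
    (hx : p⁻¹ * x.perm * p ∈ H) :
    ∃ s ∈ grigorchukGroup, pair x.top (s⁻¹ * x.next.perm * s) ∈ H := by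
  obtain ⟨t₀', ht₀, t₁', ht₁, h | h⟩ := exists_pair (hH ht)
  · exact absurd (h.symm.trans hte) (pair_ne_pair_mul_a _ _ _ _)
  have key : ∃ u ∈ grigorchukGroup, ∃ v ∈ grigorchukGroup,
      pair (u⁻¹ * x.top * u) (v⁻¹ * x.next.perm * v) ∈ H := by
    obtain ⟨u, hu, v, hv, rfl | rfl⟩ := exists_pair hp
    · refine ⟨u, hu, v, hv, ?_⟩
      rwa [x.perm_eq, pair_inv, pair_mul, pair_mul] at hx
    · refine ⟨u * t₁', mul_mem hu ht₁, v * t₀', mul_mem hv ht₀, ?_⟩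
      have : (pair u v * σa)⁻¹ * x.perm * (pair u v * σa) =
          pair (v⁻¹ * x.next.perm * v) (u⁻¹ * x.top * u) := by
        rw [x.perm_eq]; exact a_conj_pair_of_eq rfl _ _
      rw [this] at hx
      have h1 := mul_mem (mul_mem (inv_mem ht) hx) ht
      rw [a_conj_pair_of_eq h] at h1
      simpa only [mul_inv_rev, mul_assoc] using h1
  obtain ⟨u, hu, v, hv, huv⟩ := key
  obtain ⟨w, hw⟩ := hs hu
  refine ⟨v * w⁻¹, mul_mem hv (inv_mem (mem_of_pair_mem (hH hw)).2), ?_⟩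
  have h1 := mul_mem (mul_mem hw huv) (inv_mem hw)
  rw [pair_inv, pair_mul, pair_mul] at h1
  convert h1 using 2 <;> group

theorem grigorchukGroup_le_of_section {x y : Letter} (hxy : x ≠ y) {p q g : Perm (List Bool)}
    (hp : p ∈ grigorchukGroup) (hq : q ∈ grigorchukGroup) (hg : g ∈ grigorchukGroup)
    (hx : p⁻¹ * x.perm * p ∈ H) (hy : q⁻¹ * y.perm * q ∈ H) (ha : g⁻¹ * σa * g ∈ H) :
    grigorchukGroup ≤ H := by
  have ht₁ : t₁ ∈ grigorchukGroup := by
    have := mul_mem (hH ht) a_mem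
    rw [hte, mul_assoc, State.perm_mul_self, mul_one] at this
    exact (mem_of_pair_mem this).2
  obtain ⟨s, hs', hsx⟩ := exists_pair_top_mem hH hs ht hte hp hx
  obtain ⟨r, hr', hry⟩ := exists_pair_top_mem hH hs ht hte hq hy
  -- The letter d gives such a pair directly. Otherwise both tops are a and cancel in a quotient;
  -- its other entry is nontrivial because level signs are conjugation invariant and distinguish the
  -- next letters.
  have key : ∃ n ∈ grigorchukGroup, n ≠ 1 ∧ pair 1 n ∈ H := by
    have single : ∀ (x : Letter) (s : Perm (List Bool)), s ∈ grigorchukGroup → x.top = 1 →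
        pair x.top (s⁻¹ * x.next.perm * s) ∈ H →
        ∃ n ∈ grigorchukGroup, n ≠ 1 ∧ pair 1 n ∈ H := by
      intro x s hs' hx hsx
      refine ⟨_, mul_mem (mul_mem (inv_mem hs') (Letter.perm_mem _)) hs', fun h => ?_, hx ▸ hsx⟩
      obtain ⟨n, hn⟩ := x.next.exists_levelSign_ne_one
      apply hn
      rw [← levelSign_conj' n hs' x.next.perm_mem, h, levelSign_one]
    by_cases h1 : x.top = 1
    · exact single x s hs' h1 hsx
    by_cases h2 : y.top = 1
    · exact single y r hr' h2 hry
    have h3 : x.top = y.top := by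
      rw [Letter.top_eq_a (by rintro rfl; exact h1 rfl),
        Letter.top_eq_a (by rintro rfl; exact h2 rfl)]
    have hX := mul_mem (mul_mem (inv_mem hs') x.next.perm_mem) hs'
    have hY := mul_mem (mul_mem (inv_mem hr') y.next.perm_mem) hr'
    refine ⟨_, mul_mem (inv_mem hX) hY, fun h => ?_, ?_⟩
    · obtain ⟨n, hn⟩ := Letter.exists_levelSign_mul_ne_one (Letter.next_ne hxy)
      apply hn
      rw [levelSign_mul n x.next.perm_mem y.next.perm_mem, ← levelSign_conj' n hs' x.next.perm_mem,
        ← levelSign_conj' n hr' y.next.perm_mem, ← levelSign_inv n hX,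
        ← levelSign_mul n (inv_mem hX) hY, h, levelSign_one]
    · have := mul_mem (inv_mem hsx) hry
      rwa [pair_inv, pair_mul, h3, inv_mul_cancel] at this
  obtain ⟨n, hn, hn1, hnH⟩ := key
  have hN := isNormalIn_rigidPart_of_section hs
  have hc : IsCongruence (rigidPart H) := by
    refine hN.isCongruence_of_ne_one (n := t₁⁻¹ * n * t₁)
      ⟨mul_mem (mul_mem (inv_mem ht₁) hn) ht₁, ?_⟩ ?_
    · have := mul_mem (mul_mem (inv_mem ht) hnH) ht
      rw [a_conj_pair_of_eq hte] at this
      simpa using this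
    · intro h
      apply hn1
      calc n = t₁ * (t₁⁻¹ * n * t₁) * t₁⁻¹ := by group
        _ = 1 := by rw [h]; group
  have hcH : IsCongruence H := by
    refine hc.of_pair (fun _ hn => hn.2) fun n hn => ?_
    have h1 := mul_mem (mul_mem ht (hN.conj_mem' ht₁ hn).2) (inv_mem ht)
    convert h1 using 1
    rw [eq_mul_inv_iff_mul_eq, ← inv_mul_eq_iff_eq_mul, ← mul_assoc, a_conj_pair_of_eq hte]
    simp
  refine hcH.grigorchukGroup_le (Letter.grigorchukGroup_le_closure hxy) ?_ ?_
  · rintro _ (rfl | rfl | rfl)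
    exacts [a_mem, Letter.perm_mem _, Letter.perm_mem _]
  · rintro _ (rfl | rfl | rfl)
    exacts [⟨g, hg, ha⟩, ⟨p, hp, hx⟩, ⟨q, hq, hy⟩]

end FullSection

/-! ### Generation by conjugates, and its inheritance from sections -/

/-- Every subgroup of the Grigorchuk group that contains `x ^ p`, `y ^ q` and `a ^ g` is the
whole group. -/
def ConjGenerates (x y : Letter) (p q g : Perm (List Bool)) : Prop :=
  ∀ H ≤ grigorchukGroup, p⁻¹ * x.perm * p ∈ H → q⁻¹ * y.perm * q ∈ H → g⁻¹ * σa * g ∈ H →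
    grigorchukGroup ≤ H

namespace ConjGenerates

variable {x y : Letter} {p q g : Perm (List Bool)}

theorem symm (h : ConjGenerates x y p q g) : ConjGenerates y x q p g :=
  fun H hH hy hx ha => h H hH hx hy ha

theorem of_mul_right {r : Perm (List Bool)} (hr : r ∈ grigorchukGroup)
    (h : ConjGenerates x y (p * r) (q * r) (g * r)) : ConjGenerates x y p q g := by
  intro H hH hx hy ha z hz
  have hle : H.comap (MulAut.conj r).toMonoidHom ≤ grigorchukGroup := by
    intro w hw
    have h1 : r * w * r⁻¹ ∈ grigorchukGroup := hH hw
    have h2 := mul_mem (mul_mem (inv_mem hr) h1) hr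
    simpa [mul_assoc] using h2
  have key : ∀ {u s : Perm (List Bool)}, u⁻¹ * s * u ∈ H →
      (u * r)⁻¹ * s * (u * r) ∈ H.comap (MulAut.conj r).toMonoidHom := by
    intro u s hu
    rw [Subgroup.mem_comap]
    convert hu using 1
    simp [mul_assoc]
  have := h _ hle (key hx) (key hy) (key ha) (mul_mem (mul_mem (inv_mem hr) hz) hr)
  rw [Subgroup.mem_comap] at this
  simpa [mul_assoc] using this

theorem of_a_mul (h : ConjGenerates x y p q (σa * g)) : ConjGenerates x y p q g := by
  intro H hH hx hy ha
  refine h H hH hx hy ?_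
  rwa [mul_inv_rev, State.perm_inv, ← mul_assoc, mul_assoc g⁻¹, State.perm_mul_self, mul_one]

/-- Descent to the section at `0`. -/
theorem of_sections (hx : x ≠ Letter.d) (hxy : x ≠ y) {p₀ p₁ q' g₀ g₁ : Perm (List Bool)}
    (hp : pair p₀ p₁ ∈ grigorchukGroup) (hq : q ∈ grigorchukGroup)
    (hg : pair g₀ g₁ ∈ grigorchukGroup)
    (hq' : (∃ q₀ q₁, q = pair q₀ q₁ ∧ q' = q₁ * g₁⁻¹ * g₀) ∨ ∃ q₀, q = pair q₀ q' * σa)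
    (h : ConjGenerates x.next y.next (p₁ * g₁⁻¹ * g₀) q' p₀) :
    ConjGenerates x y (pair p₀ p₁) q (pair g₀ g₁) := by
  intro H hH hxH hyH haH
  obtain ⟨hp₀, hp₁⟩ := mem_of_pair_mem hp
  obtain ⟨hg₀, hg₁⟩ := mem_of_pair_mem hg
  have ht : (pair g₀ g₁)⁻¹ * σa * pair g₀ g₁ = pair (g₀⁻¹ * g₁) (g₁⁻¹ * g₀) * σa := by
    rw [mul_assoc, a_mul_pair, ← mul_assoc, pair_inv, pair_mul]
  have hs : grigorchukGroup ≤ sectionSubgroup H := by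
    have hx1 : pair (p₀⁻¹ * σa * p₀) (p₁⁻¹ * x.next.perm * p₁) ∈ H := by
      rwa [x.perm_eq, Letter.top_eq_a hx, pair_inv, pair_mul, pair_mul] at hxH
    -- The conjugate of a in H exchanges the subtrees, bringing sections at 1 to 0.
    have swap : ∀ {u s z : Perm (List Bool)}, pair u (s⁻¹ * z * s) ∈ H →
        (s * g₁⁻¹ * g₀)⁻¹ * z * (s * g₁⁻¹ * g₀) ∈ sectionSubgroup H := by
      intro u s z hu
      refine ⟨(g₀⁻¹ * g₁)⁻¹ * u * (g₀⁻¹ * g₁), ?_⟩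
      have := mul_mem (mul_mem (inv_mem haH) hu) haH
      rw [a_conj_pair_of_eq ht] at this
      convert this using 2
      group
    refine h _ ?_ (swap hx1) ?_ ⟨_, hx1⟩
    · rintro u ⟨v, hv⟩
      exact (mem_of_pair_mem (hH hv)).1
    · rcases hq' with ⟨q₀, q₁, rfl, rfl⟩ | ⟨q₀, rfl⟩
      · rw [y.perm_eq, pair_inv, pair_mul, pair_mul] at hyH
        exact swap hyH
      · refine ⟨q₀⁻¹ * y.top * q₀, ?_⟩
        rwa [y.perm_eq, a_conj_pair_of_eq rfl] at hyH
  exact grigorchukGroup_le_of_section hH hs haH ht hxy hp hq hg hxH hyH haH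

end ConjGenerates

/-! ### Weights of words -/

/-- `g` is represented by a word of weight at most `n`. -/
inductive HasWeight : ℕ → Perm (List Bool) → Prop
  | one (n : ℕ) : HasWeight n 1
  | mul_a {n : ℕ} {g : Perm (List Bool)} : HasWeight n g → HasWeight (n + 3) (g * σa)
  | mul_letter {n : ℕ} {g : Perm (List Bool)} (x : Letter) :
      HasWeight n g → HasWeight (n + x.weight) (g * x.perm)

namespace HasWeight

variable {n m : ℕ} {g h : Perm (List Bool)}

theorem mul (hg : HasWeight n g) (hh : HasWeight m h) : HasWeight (n + m) (g * h) := by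
  induction hh with
  | one k =>
    rw [mul_one]
    induction hg with
    | one n => exact .one _
    | mul_a _ ih => rw [add_right_comm]; exact ih.mul_a
    | mul_letter x _ ih => rw [add_right_comm]; exact ih.mul_letter x
  | mul_a _ ih => rw [← add_assoc, ← mul_assoc]; exact ih.mul_a
  | mul_letter x _ ih => rw [← add_assoc, ← mul_assoc]; exact ih.mul_letter x

theorem a : HasWeight 3 σa := by simpa using (HasWeight.one 0).mul_a

theorem letter (x : Letter) : HasWeight x.weight x.perm := by
  simpa using (HasWeight.one 0).mul_letter x

theorem inv (hg : HasWeight n g) : HasWeight n g⁻¹ := by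
  induction hg with
  | one n => rw [inv_one]; exact .one n
  | mul_a _ ih => rw [mul_inv_rev, State.perm_inv, add_comm]; exact a.mul ih
  | mul_letter x _ ih => rw [mul_inv_rev, x.perm_inv, add_comm]; exact (letter x).mul ih

end HasWeight

/-- The product `a x₁ a x₂ ⋯ a xₘ` for a list of letters `x₁, …, xₘ`. -/
def altWord : List Letter → Perm (List Bool)
  | [] => 1
  | x :: P => σa * x.perm * altWord P

/-- The weight of the word `a x₁ a x₂ ⋯ a xₘ`. -/
def altWeight : List Letter → ℕ
  | [] => 0
  | x :: P => 3 + x.weight + altWeight P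

theorem altWord_append (P Q : List Letter) : altWord (P ++ Q) = altWord P * altWord Q := by
  induction P with
  | nil => simp [altWord]
  | cons x P ih => simp [altWord, ih, mul_assoc]

theorem altWeight_append (P Q : List Letter) : altWeight (P ++ Q) = altWeight P + altWeight Q := by
  induction P with
  | nil => simp [altWeight]
  | cons x P ih => simp [altWeight, ih, add_assoc]

theorem altWord_mem (P : List Letter) : altWord P ∈ grigorchukGroup := by
  induction P with
  | nil => exact one_mem _
  | cons x P ih => exact mul_mem (mul_mem a_mem x.perm_mem) ih

/-- `1` or `a`, according to `e`. -/
def aPow (e : Bool) : Perm (List Bool) := if e then σa else 1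

theorem aPow_mem (e : Bool) : aPow e ∈ grigorchukGroup := by
  cases e
  exacts [one_mem _, a_mem]

theorem Letter.le_weight (x : Letter) : 10 ≤ x.weight := by cases x <;> decide

/-- The weights are tuned so that a block a x outweighs its two sections by exactly one: 3 + 12 = 11
+ 3 + 1, 3 + 11 = 10 + 3 + 1, 3 + 10 = 12 + 0 + 1. -/
theorem Letter.exists_sections_weight (x : Letter) : ∃ n₀ n₁, HasWeight n₀ x.next.perm ∧
    HasWeight n₁ x.top ∧ n₀ ≤ 12 ∧ n₁ ≤ 3 ∧ n₀ + n₁ + 1 ≤ 3 + x.weight := by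
  cases x
  · exact ⟨11, 3, .letter .c, .a, by decide, by decide, by decide⟩
  · exact ⟨10, 3, .letter .d, .a, by decide, by decide, by decide⟩
  · exact ⟨12, 0, .letter .b, .one 0, by decide, by decide, by decide⟩

theorem exists_sections_altWord (P : List Letter) : ∃ u₀ u₁ n₀ n₁,
    HasWeight n₀ u₀ ∧ HasWeight n₁ u₁ ∧ n₀ + n₁ + P.length ≤ altWeight P ∧
    (P ≠ [] → n₁ + 10 ≤ altWeight P) ∧
    (altWord P = pair u₀ u₁ ∨ altWord P = pair u₀ u₁ * σa) := by
  induction P with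
  | nil => exact ⟨1, 1, 0, 0, .one 0, .one 0, by simp [altWeight], by simp, by simp [altWord]⟩
  | cons x P ih =>
    obtain ⟨u₀, u₁, n₀, n₁, h₀, h₁, hn, -, hP⟩ := ih
    obtain ⟨m₀, m₁, hm₀, hm₁, hm, hm', hm''⟩ := x.exists_sections_weight
    have hx := x.le_weight
    refine ⟨x.next.perm * u₁, x.top * u₀, m₀ + n₁, m₁ + n₀, hm₀.mul h₁, hm₁.mul h₀, ?_, ?_, ?_⟩
    · simp only [altWeight, List.length_cons]; omega
    · intro _; simp only [altWeight]; omega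
    · rcases hP with hP | hP <;> rw [altWord, hP, x.perm_eq, a_mul_pair, mul_assoc]
      · right; rw [a_mul_pair, ← mul_assoc, pair_mul]
      · left; rw [a_mul_pair_mul, State.perm_mul_self, mul_one, pair_mul]

/-- `p` has the same action on `B = {1, b, c, d}` by conjugation as a product
`a x₁ ⋯ a xₘ` or `a x₁ ⋯ a xₘ a` of weight at most `n`. -/
def LetterWeight (n : ℕ) (p : Perm (List Bool)) : Prop :=
  ∃ P e, altWeight P + 3 * e.toNat ≤ n ∧
    ∀ x : Letter, p⁻¹ * x.perm * p = (altWord P * aPow e)⁻¹ * x.perm * (altWord P * aPow e)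

/-- `g` conjugates `a` in the same way as a product `a x₁ ⋯ a xₘ` or `a x₁ ⋯ a xₘ a`
of weight at most `n`. -/
def AWeight (n : ℕ) (g : Perm (List Bool)) : Prop :=
  ∃ R e, altWeight R + 3 * e.toNat ≤ n ∧ (R = [] → e = true) ∧
    g⁻¹ * σa * g = (altWord R * aPow e)⁻¹ * σa * (altWord R * aPow e)

/-- The element of `B = {1, b, c, d}` given by an optional letter. -/
def optPerm : Option Letter → Perm (List Bool)
  | none => 1
  | some x => x.perm

/-- The weight of an optional letter. -/
def optWeight : Option Letter → ℕ
  | none => 0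
  | some x => x.weight

theorem optPerm_mul_comm (β : Option Letter) (x : Letter) :
    optPerm β * x.perm = x.perm * optPerm β := by
  cases β with
  | none => simp [optPerm]
  | some y => exact y.perm_mul_comm x

theorem aPow_mul_a (e : Bool) : aPow e * σa = aPow (!e) := by
  cases e
  · simp [aPow]
  · simp [aPow, State.perm_mul_self]

theorem altWord_concat (P : List Letter) (x : Letter) :
    altWord (P ++ [x]) = altWord P * σa * x.perm := by
  rw [altWord_append, altWord, altWord, mul_one, mul_assoc]

theorem altWeight_concat (P : List Letter) (x : Letter) :
    altWeight (P ++ [x]) = altWeight P + 3 + x.weight := by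
  rw [altWeight_append, altWeight, altWeight]; omega

theorem altWord_mul_letter {P : List Letter} (hP : P ≠ []) (x : Letter) :
    ∃ P' e, altWeight P' + 3 * e.toNat < altWeight P + x.weight ∧
      altWord P * x.perm = altWord P' * aPow e := by
  obtain ⟨P', y, rfl⟩ := List.eq_nil_or_concat P |>.resolve_left hP
  simp only [List.concat_eq_append] at *
  have := x.le_weight
  rw [altWeight_concat, altWord_concat, mul_assoc]
  rcases y.perm_mul_cases x with h | ⟨z, h, hz⟩ <;> rw [h]
  · exact ⟨P', true, by simp; omega, by simp [aPow]⟩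
  · refine ⟨P' ++ [z], false, ?_, ?_⟩
    · rw [altWeight_concat]; simp; omega
    · rw [altWord_concat]; simp [aPow]

theorem HasWeight.exists_form {n : ℕ} {g : Perm (List Bool)} (hg : HasWeight n g) :
    ∃ β P e, optWeight β + altWeight P + 3 * e.toNat ≤ n ∧
      g = optPerm β * altWord P * aPow e := by
  induction hg with
  | one n => exact ⟨none, [], false, by simp [optWeight, altWeight], by simp [optPerm, altWord, aPow]⟩
  | mul_a _ ih =>
    obtain ⟨β, P, e, hn, rfl⟩ := ih
    refine ⟨β, P, !e, ?_, by rw [mul_assoc, aPow_mul_a]⟩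
    cases e <;> simp at hn ⊢ <;> omega
  | @mul_letter n g x _ ih =>
    obtain ⟨β, P, e, hn, rfl⟩ := ih
    cases e
    · simp only [Bool.toNat_false, mul_zero, add_zero] at hn
      by_cases hP : P = []
      · subst hP
        rcases β with _ | y
        · exact ⟨some x, [], false, by simp [optWeight, altWeight],
            by simp [optPerm, altWord, aPow]⟩
        · simp only [optWeight, altWeight, add_zero] at hn
          rcases y.perm_mul_cases x with h | ⟨z, h, hz⟩
          · exact ⟨none, [], false, by simp [optWeight, altWeight],
              by simp [optPerm, altWord, aPow, h]⟩
          · exact ⟨some z, [], false, by simp [optWeight, altWeight]; omega,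
              by simp [optPerm, altWord, aPow, h]⟩
      · obtain ⟨P', e, h1, h2⟩ := altWord_mul_letter hP x
        exact ⟨β, P', e, by omega, by simp only [aPow, Bool.false_eq_true, if_false, mul_one,
          mul_assoc, h2]⟩
    · refine ⟨β, P ++ [x], false, ?_, ?_⟩
      · rw [altWeight_concat]; simp at hn ⊢; omega
      · rw [altWord_concat]; simp [aPow, mul_assoc]

/-- A leading letter commutes with b, c, d, so it can be dropped. -/
theorem HasWeight.letterWeight {n : ℕ} {g : Perm (List Bool)} (hg : HasWeight n g) :
    LetterWeight n g := by
  obtain ⟨β, P, e, hn, rfl⟩ := hg.exists_form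
  refine ⟨P, e, by omega, fun x => ?_⟩
  have h : (optPerm β)⁻¹ * x.perm * optPerm β = x.perm := by
    rw [mul_assoc, ← optPerm_mul_comm, inv_mul_cancel_left]
  calc _ = (altWord P * aPow e)⁻¹ * ((optPerm β)⁻¹ * x.perm * optPerm β) *
        (altWord P * aPow e) := by group
    _ = _ := by rw [h]

/-- Prefixing a does not change the conjugate of a but completes a leading letter to a block, at
cost 3. The empty word is replaced by a, so the bound is never below 3. -/
theorem HasWeight.aWeight {n : ℕ} {g : Perm (List Bool)} (hg : HasWeight n g) :
    AWeight (n + 3) g := by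
  have hconj : ∀ h : Perm (List Bool), h⁻¹ * σa * h = (σa * h)⁻¹ * σa * (σa * h) := by
    intro h
    rw [mul_inv_rev, State.perm_inv, mul_assoc (h⁻¹ * σa), a_mul_a_mul]
  obtain ⟨β, P, e, hn, rfl⟩ := hg.exists_form
  rcases β with _ | x
  · by_cases hP : P = []
    · subst hP
      refine ⟨[], true, by simp [altWeight], fun _ => rfl, ?_⟩
      cases e
      · rw [hconj]; simp [optPerm, altWord, aPow]
      · simp [optPerm, altWord, aPow]
    · exact ⟨P, e, by simp only [optWeight] at hn; omega, fun h => absurd h hP,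
        by simp only [optPerm, one_mul]⟩
  · refine ⟨x :: P, e, ?_, by simp, ?_⟩
    · simp only [optWeight, altWeight] at hn ⊢; omega
    · rw [hconj]; simp only [optPerm, altWord, mul_assoc]

theorem letterWeight_altWord_mul_letter (P : List Letter) (r : Letter) :
    ∃ n < altWeight P + r.weight, LetterWeight n (altWord P * r.perm) := by
  by_cases hP : P = []
  · have := r.le_weight
    refine ⟨0, by omega, [], false, by simp [altWeight], fun x => ?_⟩
    subst hP
    simp only [altWord, one_mul, aPow, Bool.false_eq_true, if_false, inv_one, mul_one]
    rw [r.perm_inv, r.perm_mul_comm, mul_assoc, r.perm_mul_self, mul_one]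
  · obtain ⟨P', e, h1, h2⟩ := altWord_mul_letter hP r
    exact ⟨_, h1, P', e, le_rfl, fun x => by rw [h2]⟩

/-! ### The descent -/

theorem conjGenerates_of_weight_sections {T : ℕ}
    (ih : ∀ x y : Letter, x ≠ y → ∀ p q g n₁ n₂ n₃, LetterWeight n₁ p → LetterWeight n₂ q →
      AWeight n₃ g → n₁ + n₂ + n₃ < T → ConjGenerates x y p q g)
    {x y : Letter} (hx : x ≠ Letter.d) (hxy : x ≠ y)
    {p₀ p₁ q q₀ q₁ g₀ g₁ : Perm (List Bool)} {n₀ n₁ k m₀ m₁ : ℕ}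
    (hp : pair p₀ p₁ ∈ grigorchukGroup) (hq : q ∈ grigorchukGroup)
    (hg : pair g₀ g₁ ∈ grigorchukGroup)
    (hq' : q = pair q₀ q₁ ∨ q = pair q₀ q₁ * σa)
    (hn₀ : HasWeight n₀ p₀) (hn₁ : HasWeight n₁ p₁) (hk : HasWeight k q₁) (hm₀ : HasWeight m₀ g₀)
    (hm₁ : HasWeight m₁ g₁) (hT : n₀ + n₁ + k + m₀ + m₁ + 3 < T) :
    ConjGenerates x y (pair p₀ p₁) q (pair g₀ g₁) := by
  have hg' := mem_of_pair_mem hg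
  rcases hq' with rfl | rfl
  · refine .of_sections hx hxy hp hq hg (.inl ⟨_, _, rfl, rfl⟩) ?_
    -- This moves g₀ and g₁ from both letter conjugators to the single conjugator of a, so that
    -- their weights are counted once.
    refine .of_mul_right (r := g₀⁻¹ * g₁) (mul_mem (inv_mem hg'.1) hg'.2) ?_
    rw [mul_assoc, mul_assoc, mul_assoc, mul_assoc, mul_inv_cancel_left, inv_mul_cancel, mul_one,
      mul_one]
    exact ih _ _ (Letter.next_ne hxy) _ _ _ _ _ _ hn₁.letterWeight hk.letterWeight
      (hn₀.mul (hm₀.inv.mul hm₁)).aWeight (by omega)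
  · refine .of_sections hx hxy hp hq hg (.inr ⟨_, rfl⟩) ?_
    exact ih _ _ (Letter.next_ne hxy) _ _ _ _ _ _ ((hn₁.mul hm₁.inv).mul hm₀).letterWeight
      hk.letterWeight hn₀.aWeight (by omega)

theorem eq_pair_or_mul_aPow {u u₀ u₁ : Perm (List Bool)} (h : u = pair u₀ u₁ ∨ u = pair u₀ u₁ * σa)
    (e : Bool) : u * aPow e = pair u₀ u₁ ∨ u * aPow e = pair u₀ u₁ * σa := by
  cases e
  · simpa [aPow] using h
  · rcases h with rfl | rfl
    · exact .inr rfl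
    · exact .inl (by simp [aPow, mul_assoc, State.perm_mul_self])

theorem conjGenerates_of_weight (T : ℕ) : ∀ x y : Letter, x ≠ y → ∀ p q g n₁ n₂ n₃,
    LetterWeight n₁ p → LetterWeight n₂ q → AWeight n₃ g → n₁ + n₂ + n₃ ≤ T →
    ConjGenerates x y p q g := by
  induction T using Nat.strong_induction_on with
  | _ T ih =>
  have ih' : ∀ x y : Letter, x ≠ y → ∀ p q g n₁ n₂ n₃, LetterWeight n₁ p → LetterWeight n₂ q →
      AWeight n₃ g → n₁ + n₂ + n₃ < T → ConjGenerates x y p q g :=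
    fun x y hxy p q g n₁ n₂ n₃ h₁ h₂ h₃ h => ih _ h x y hxy p q g n₁ n₂ n₃ h₁ h₂ h₃ le_rfl
  intro x y hxy p q g n₁ n₂ n₃ h₁ h₂ h₃ hT
  wlog hx : x ≠ Letter.d generalizing x y p q n₁ n₂
  · push Not at hx
    exact (this y x hxy.symm q p n₂ n₁ h₂ h₁ (by omega) (by rintro rfl; exact hxy hx)).symm
  obtain ⟨P, ε, hP, hp⟩ := h₁
  obtain ⟨Q, δ, hQ, hq⟩ := h₂
  obtain ⟨R, ζ, hR, hζ, hg⟩ := h₃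
  suffices ConjGenerates x y (altWord P * aPow ε) (altWord Q * aPow δ) (altWord R * aPow ζ) by
    intro H hH hxH hyH haH
    exact this H hH (hp x ▸ hxH) (hq y ▸ hyH) (hg ▸ haH)
  -- Here sections may fail to lower the weight. Multiplying all conjugators by the last letter r of
  -- R strips it from R, and P r is lighter than P and r together.
  by_cases hA : Q = [] ∧ ε = false ∧ δ = false ∧ ζ = false
  · obtain ⟨rfl, rfl, rfl, rfl⟩ := hA
    have hRne : R ≠ [] := fun h => by simpa using hζ h
    obtain ⟨R, r, rfl⟩ := (List.eq_nil_or_concat R).resolve_left hRne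
    simp only [List.concat_eq_append, altWeight_concat, Bool.toNat_false, mul_zero, add_zero,
      altWeight] at hP hQ hR
    obtain ⟨n, hn, hPr⟩ := letterWeight_altWord_mul_letter P r
    obtain ⟨-, -, hQr⟩ := letterWeight_altWord_mul_letter [] r
    refine .of_mul_right r.perm_mem ?_
    have e1 : altWord (R.concat r) * aPow false * r.perm = altWord R * aPow true := by
      simp [List.concat_eq_append, altWord_concat, aPow, mul_assoc, r.perm_mul_self]
    rw [e1]
    refine ih' x y hxy _ _ _ n 0 (altWeight R + 3) (by simpa [aPow] using hPr) ?_
      ⟨R, true, by simp, fun _ => rfl, rfl⟩ (by omega)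
    refine ⟨[], false, by simp [altWeight], fun z => ?_⟩
    simp only [altWord, one_mul, aPow, Bool.false_eq_true, if_false, inv_one, mul_one]
    rw [r.perm_inv, r.perm_mul_comm, mul_assoc, r.perm_mul_self, mul_one]
  by_cases hB : P = [] ∧ Q = [] ∧ R = [] ∧ ε = false ∧ δ = false
  · obtain ⟨rfl, rfl, rfl, rfl, rfl⟩ := hB
    obtain rfl := hζ rfl
    intro H hH hxH hyH haH
    refine (Letter.grigorchukGroup_le_closure hxy).trans ((Subgroup.closure_le _).2 ?_)
    simp only [altWord, aPow, Bool.false_eq_true, if_false, if_true, mul_one, one_mul, inv_one,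
      State.perm_inv, State.perm_mul_self] at hxH hyH haH
    rintro _ (rfl | rfl | rfl) <;> assumption
  obtain ⟨p₀, p₁, n₀, n₁', hp₀, hp₁, hn, -, hpe⟩ := exists_sections_altWord P
  obtain ⟨q₀, q₁, l₀, k, -, hk, hkQ, hkQ', hqe⟩ := exists_sections_altWord Q
  obtain ⟨g₀, g₁, m₀, m₁, hg₀, hg₁, hm, -, hge⟩ := exists_sections_altWord R
  -- The extra 3 must be paid for. If Q is nonempty, only its section at 1 is used, saving 10.
  -- Otherwise a trailing a saves 3, and a block of P or R or a second trailing a gives strictness.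
  have hlt : n₀ + n₁' + k + m₀ + m₁ + 3 < T := by
    by_cases hQne : Q = []
    · subst hQne
      simp only [altWeight] at hkQ hQ
      simp only [true_and] at hA hB
      by_cases hPR : P = [] ∧ R = []
      · obtain ⟨rfl, rfl⟩ := hPR
        obtain rfl := hζ rfl
        cases ε <;> cases δ <;> simp_all <;> omega
      · have : 0 < P.length + R.length := by
          by_contra h0
          apply hPR
          rw [← List.length_eq_zero_iff, ← List.length_eq_zero_iff]
          omega
        cases ε <;> cases δ <;> cases ζ <;>
          simp only [Bool.toNat_false, Bool.toNat_true] at hP hQ hR <;>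
          first | exact absurd ⟨rfl, rfl, rfl⟩ hA | omega
    · have := hkQ' hQne
      omega
  have hpG := mul_mem (altWord_mem P) (aPow_mem ε)
  have hqG := mul_mem (altWord_mem Q) (aPow_mem δ)
  have hgG := mul_mem (altWord_mem R) (aPow_mem ζ)
  have hpe := eq_pair_or_mul_aPow hpe ε
  have hqe := eq_pair_or_mul_aPow hqe δ
  have hge := eq_pair_or_mul_aPow hge ζ
  generalize altWord P * aPow ε = p' at hpG hpe
  generalize altWord Q * aPow δ = q' at hqG hqe
  generalize altWord R * aPow ζ = g' at hgG hge
  have main : ∀ {g₀ g₁ : Perm (List Bool)} {m₀ m₁ : ℕ}, HasWeight m₀ g₀ → HasWeight m₁ g₁ →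
      n₀ + n₁' + k + m₀ + m₁ + 3 < T → pair g₀ g₁ ∈ grigorchukGroup →
      ConjGenerates x y p' q' (pair g₀ g₁) := by
    intro g₀ g₁ m₀ m₁ hg₀ hg₁ hlt hgm
    rcases hpe with rfl | rfl
    · exact conjGenerates_of_weight_sections ih' hx hxy hpG hqG hgm hqe hp₀ hp₁ hk hg₀ hg₁ hlt
    -- Right multiplication by a removes the swap from p; the left factor a then turns the
    -- conjugator of a into (g₁, g₀).
    · refine .of_mul_right a_mem (.of_a_mul ?_)
      rw [← mul_assoc, a_conj_pair, mul_assoc, State.perm_mul_self, mul_one]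
      have hpG' := mul_mem hpG a_mem
      rw [mul_assoc, State.perm_mul_self, mul_one] at hpG'
      exact conjGenerates_of_weight_sections ih' hx hxy hpG' (mul_mem hqG a_mem)
        (pair_swap_mem hgm) (eq_pair_or_mul_aPow hqe true) hp₀ hp₁ hk hg₁ hg₀ (by omega)
  rcases hge with rfl | rfl
  · exact main hg₀ hg₁ hlt hgG
  · refine .of_a_mul ?_
    have hgG' := mul_mem a_mem hgG
    rw [← mul_assoc, a_conj_pair] at hgG' ⊢
    exact main hg₁ hg₀ (by omega) hgG'

theorem exists_hasWeight {g : Perm (List Bool)} (hg : g ∈ grigorchukGroup) :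
    ∃ n, HasWeight n g := by
  induction hg using Subgroup.closure_induction with
  | mem x hx =>
    rcases hx with rfl | rfl | rfl | rfl
    exacts [⟨_, .a⟩, ⟨_, .letter .b⟩, ⟨_, .letter .c⟩, ⟨_, .letter .d⟩]
  | one => exact ⟨0, .one 0⟩
  | mul x y _ _ hx hy =>
    obtain ⟨n, hn⟩ := hx
    obtain ⟨m, hm⟩ := hy
    exact ⟨_, hn.mul hm⟩
  | inv x _ hx =>
    obtain ⟨n, hn⟩ := hx
    exact ⟨n, hn.inv⟩

/-- Conjugates of `a` and of two different letters generate the Grigorchuk group. -/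
theorem conjGenerates {x y : Letter} (hxy : x ≠ y) {p q g : Perm (List Bool)}
    (hp : p ∈ grigorchukGroup) (hq : q ∈ grigorchukGroup) (hg : g ∈ grigorchukGroup) :
    ConjGenerates x y p q g := by
  obtain ⟨n₁, h₁⟩ := exists_hasWeight hp
  obtain ⟨n₂, h₂⟩ := exists_hasWeight hq
  obtain ⟨n₃, h₃⟩ := exists_hasWeight hg
  exact conjGenerates_of_weight _ x y hxy p q g _ _ _ h₁.letterWeight h₂.letterWeight h₃.aWeight
    le_rfl

/-! ### Invariable generation -/

theorem invariablyGenerates_abc : InvariablyGenerates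
    ({⟨σa, a_mem⟩, ⟨σb, b_mem⟩, ⟨σc, c_mem⟩} : Set grigorchukGroup) := by
  intro g
  set C := Subgroup.closure ((fun s => (g s)⁻¹ * s * g s) ''
    ({⟨σa, a_mem⟩, ⟨σb, b_mem⟩, ⟨σc, c_mem⟩} : Set grigorchukGroup)) with hC
  have hmem : ∀ s ∈ ({⟨σa, a_mem⟩, ⟨σb, b_mem⟩, ⟨σc, c_mem⟩} : Set grigorchukGroup),
      ((g s : Perm (List Bool)))⁻¹ * s * g s ∈ C.map grigorchukGroup.subtype :=
    fun s hs => ⟨_, Subgroup.subset_closure ⟨s, hs, rfl⟩, rfl⟩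
  have hle := conjGenerates (x := .b) (y := .c) (by simp) (g ⟨σb, b_mem⟩).2 (g ⟨σc, c_mem⟩).2
    (g ⟨σa, a_mem⟩).2 _ (Subgroup.map_subtype_le C) (hmem ⟨σb, b_mem⟩ (by simp))
    (hmem ⟨σc, c_mem⟩ (by simp)) (hmem ⟨σa, a_mem⟩ (by simp))
  rw [eq_top_iff]
  intro s _
  obtain ⟨s', hs', h⟩ := hle s.2
  rwa [show s = s' from Subtype.ext h.symm]

/-- The signs of the actions on the first three levels. -/
noncomputable def signHom : grigorchukGroup →* ℤˣ × ℤˣ × ℤˣ where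
  toFun g := (levelSign 1 g, levelSign 2 g, levelSign 3 g)
  map_one' := by simp [levelSign_one]
  map_mul' g h := by
    simp only [Subgroup.coe_mul, levelSign_mul _ g.2 h.2, Prod.mk_mul_mk]

theorem signHom_apply (g : grigorchukGroup) :
    signHom g = (levelSign 1 (g : Perm (List Bool)), levelSign 2 (g : Perm (List Bool)),
      levelSign 3 (g : Perm (List Bool))) := rfl

/-- The character of `(ℤˣ)³` with exponents `i`, `j`, `k`. -/
def signCharacter (i j k : ℕ) : ℤˣ × ℤˣ × ℤˣ →* ℤˣ where
  toFun u := u.1 ^ i * u.2.1 ^ j * u.2.2 ^ k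
  map_one' := by simp
  map_mul' u v := by
    simp only [Prod.fst_mul, Prod.snd_mul, mul_pow]
    simp only [mul_assoc, mul_left_comm]

/-- Two linear conditions on the three-dimensional dual of 𝔽₂³ have a nonzero solution. -/
theorem exists_signCharacter_eq_one : ∀ u v : ℤˣ × ℤˣ × ℤˣ, ∃ i j k : Fin 2,
    ¬ (i = 0 ∧ j = 0 ∧ k = 0) ∧ signCharacter i j k u = 1 ∧ signCharacter i j k v = 1 := by
  decide +kernel

/-- The three vectors are the level signs of a, c, d, a basis of 𝔽₂³. -/
theorem eq_zero_of_signCharacter_eq_one : ∀ i j k : Fin 2,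
    signCharacter i j k (-1, 1, 1) = 1 → signCharacter i j k (1, -1, 1) = 1 →
      signCharacter i j k (1, 1, -1) = 1 → i = 0 ∧ j = 0 ∧ k = 0 := by
  decide +kernel

theorem closure_pair_ne_top (u v : grigorchukGroup) :
    Subgroup.closure {u, v} ≠ ⊤ := by
  intro h
  obtain ⟨i, j, k, hne, hu, hv⟩ := exists_signCharacter_eq_one (signHom u) (signHom v)
  have hker : Subgroup.closure {u, v} ≤ ((signCharacter i j k).comp signHom).ker := by
    rw [Subgroup.closure_le]
    rintro w (rfl | rfl)
    · exact MonoidHom.mem_ker.2 hu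
    · exact MonoidHom.mem_ker.2 hv
  rw [h] at hker
  have key : ∀ (g : Perm (List Bool)) (hg : g ∈ grigorchukGroup), signCharacter i j k
      (levelSign 1 g, levelSign 2 g, levelSign 3 g) = 1 := by
    intro g hg
    have h1 := MonoidHom.mem_ker.1 (hker (Subgroup.mem_top ⟨g, hg⟩))
    rwa [MonoidHom.comp_apply, signHom_apply] at h1
  have ha := key _ a_mem
  have hc := key _ c_mem
  have hd := key _ d_mem
  rw [levelSign_one_a, levelSign_two_a, levelSign_three_a] at ha
  rw [levelSign_one_c, levelSign_two_c, levelSign_three_c] at hc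
  rw [levelSign_one_d, levelSign_two_d, levelSign_three_d] at hd
  exact hne (eq_zero_of_signCharacter_eq_one i j k ha hc hd)

theorem three_le_card_of_invariablyGenerates {S : Finset grigorchukGroup}
    (hS : InvariablyGenerates (S : Set grigorchukGroup)) : 3 ≤ S.card := by
  by_contra! h
  have htop : Subgroup.closure (S : Set grigorchukGroup) = ⊤ := by simpa using hS fun _ => 1
  obtain ⟨u, v, huv⟩ : ∃ u v : grigorchukGroup, (S : Set grigorchukGroup) ⊆ {u, v} := by
    have : S.card = 0 ∨ S.card = 1 ∨ S.card = 2 := by omega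
    rcases this with h | h | h
    · rw [Finset.card_eq_zero] at h
      exact ⟨1, 1, by simp [h]⟩
    · obtain ⟨u, rfl⟩ := Finset.card_eq_one.1 h
      exact ⟨u, u, by simp⟩
    · classical
      obtain ⟨u, v, -, rfl⟩ := Finset.card_eq_two.1 h
      exact ⟨u, v, by simp⟩
  exact closure_pair_ne_top u v (top_le_iff.1 (htop ▸ Subgroup.closure_mono huv))

theorem exists_invariablyGenerates_card_eq_three : ∃ S : Finset grigorchukGroup,
    S.card = 3 ∧ InvariablyGenerates (S : Set grigorchukGroup) := by
  classical
  have hab : σa ≠ σb := fun h => by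
    have := congrArg (levelSign 1) h
    rw [levelSign_one_a, levelSign_one_b] at this
    exact absurd this (by decide)
  have hac : σa ≠ σc := fun h => by
    have := congrArg (levelSign 1) h
    rw [levelSign_one_a, levelSign_one_c] at this
    exact absurd this (by decide)
  have hbc : σb ≠ σc := fun h => by
    have := congrArg (levelSign 3) h
    rw [levelSign_three_b, levelSign_three_c] at this
    exact absurd this (by decide)
  refine ⟨{⟨σa, a_mem⟩, ⟨σb, b_mem⟩, ⟨σc, c_mem⟩}, ?_, ?_⟩
  · exact Finset.card_eq_three.2 ⟨_, _, _, by simpa using hab, by simpa using hac,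
      by simpa using hbc, rfl⟩
  · simpa using invariablyGenerates_abc

end Grigorchuk

theorem corollary2p7 :
    IsFIG grigorchukGroup ∧ invariableRank grigorchukGroup = 3 ∧
      Group.ResiduallyFinite grigorchukGroup ∧ ¬ IsVirtuallySolvable grigorchukGroup := by
  obtain ⟨S, hS, hgen⟩ := Grigorchuk.exists_invariablyGenerates_card_eq_three
  refine ⟨⟨S, hgen⟩, ?_, Grigorchuk.residuallyFinite, Grigorchuk.not_isVirtuallySolvable⟩
  refine le_antisymm (Nat.sInf_le ⟨S, hS, hgen⟩) (le_csInf ⟨3, S, hS, hgen⟩ ?_)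
  rintro n ⟨S', rfl, hS'⟩
  exact Grigorchuk.three_le_card_of_invariablyGenerates hS'
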